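/- Let $\Pi=(\mathcal P,\mathcal L)$ be a polar space of rank $n\ge 3$: $\mathcal P$ is a non-empty set of points, $\mathcal L$ is a family of proper subsets of $\mathcal P$ called lines, each line contains at least three points, any two distinct points lie on at most one line, no point is collinear to all other points, for every point $p$ and every line $L$ the point $p$ is collinear to precisely one point or to all points of $L$ (every point being regarded as collinear to itself), every chain of singular subspaces is finite, and the maximal singular subspaces have projective dimension $n-1$. Here a subspace is a set of points containing every line that joins two of its distinct points, and it is singular if any two of its distinct points are collinear; $\dim$ denotes projective dimension, so $\dim\emptyset=-1$. For a set $X$ of points, $X^{\perp}$ denotes the set of points collinear to every point of $X$ (again, every point being regarded as collinear to itself). Let $k$ be an integer with $0\le k\le n-2$ and let $\Gamma'_k(\Pi)$ be the graph whose vertices are the $k$-dimensional singular subspaces of $\Pi$, two vertices $X,Y$ being adjacent if and only if $$\dim(X^{\perp}\cap Y)=\dim(X\cap Y)=k-1 .$$ Then every automorphism $f$ of the graph $\Gamma'_k(\Pi)$ is induced by an automorphism of $\Pi$: there is a bijection $\sigma:\mathcal P\to\mathcal P$ such that $\sigma$ and $\sigma^{-1}$ map lines to lines and $f(X)=\sigma(X)$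 for every $k$-dimensional singular subspace $X$ of $\Pi$. -/

import Mathlib

universe u

/-- A partial linear space on the point set `P`: the lines are proper subsets of `P`, each line
contains at least two points, and two distinct points lie on at most one common line (so that
two distinct collinear points lie on precisely one line). -/
structure PartialLinearSpace (P : Type u) where
  lines : Set (Set P)
  nonempty : Nonempty P
  line_ne_univ : ∀ L ∈ lines, L ≠ Set.univ
  line_nontrivial : ∀ L ∈ lines, L.Nontrivial
  line_unique : ∀ p q : P, p ≠ q → ∀ L ∈ lines, ∀ M ∈ lines,
    p ∈ L → q ∈ L → p ∈ M → q ∈ M → L = M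

namespace PartialLinearSpace

variable {P : Type u} (S : PartialLinearSpace P)

/-- Two distinct points joined by a line are collinear. -/
def Collinear (p q : P) : Prop :=
  p ≠ q ∧ ∃ L ∈ S.lines, p ∈ L ∧ q ∈ L

/-- The relation `p ⊥ q`: collinear or equal (every point is orthogonal to itself). -/
def Perp (p q : P) : Prop :=
  p = q ∨ S.Collinear p q

/-- `X` is a subspace: it contains every line joining two distinct points of `X`. -/
def IsSubspace (X : Set P) : Prop :=
  ∀ p ∈ X, ∀ q ∈ X, p ≠ q → ∀ L ∈ S.lines, p ∈ L → q ∈ L → L ⊆ X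

/-- A singular subspace: a subspace in which any two distinct points are collinear. The empty set
and the single points are singular subspaces. -/
def IsSingular (X : Set P) : Prop :=
  S.IsSubspace X ∧ ∀ p ∈ X, ∀ q ∈ X, p ≠ q → S.Collinear p q

/-- The set `X^⊥` of all points orthogonal to every point of `X`. -/
def perp (X : Set P) : Set P :=
  {p | ∀ x ∈ X, S.Perp p x}

/-- `X` is a singular subspace of projective dimension `d`. The projective dimension of `X` is
`m - 1`, where `m` is the largest length of a chain `X₀ ⊂ X₁ ⊂ ⋯ ⊂ Xₘ = X` of singular subspaces
(every subspace contained in `X` is singular). So the empty set has dimension `-1`, a point has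
dimension `0`, a line has dimension `1`. -/
def HasDim (X : Set P) (d : ℤ) : Prop :=
  ∃ (h : S.IsSingular X) (m : ℕ),
    Order.height (⟨X, h⟩ : {Y : Set P // S.IsSingular Y}) = (m : ℕ∞) ∧ d = (m : ℤ) - 1

/-- An automorphism: a bijective transformation of the point set preserving the set of lines
(in both directions). -/
structure Automorphism where
  toEquiv : P ≃ P
  map_lines : ∀ L : Set P, toEquiv '' L ∈ S.lines ↔ L ∈ S.lines

variable {S}

theorem Perp.symm {p q : P} (h : S.Perp p q) : S.Perp q p := by
  rcases h with h | ⟨h, L, hL, hp, hq⟩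
  · exact Or.inl h.symm
  · exact Or.inr ⟨h.symm, L, hL, hq, hp⟩

theorem IsSingular.perp_of_mem {X : Set P} (h : S.IsSingular X) {p q : P} (hp : p ∈ X)
    (hq : q ∈ X) : S.Perp p q := by
  by_cases e : p = q
  · exact Or.inl e
  · exact Or.inr (h.2 p hp q hq e)

theorem IsSubspace.inter {X Y : Set P} (hX : S.IsSubspace X) (hY : S.IsSubspace Y) :
    S.IsSubspace (X ∩ Y) := fun p hp q hq e L hL hpL hqL =>
  Set.subset_inter (hX p hp.1 q hq.1 e L hL hpL hqL) (hY p hp.2 q hq.2 e L hL hpL hqL)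

theorem HasDim.unique {X : Set P} {d e : ℤ} (hd : S.HasDim X d) (he : S.HasDim X e) :
    d = e := by
  obtain ⟨_, m, hm, rfl⟩ := hd
  obtain ⟨_, l, hl, rfl⟩ := he
  have : (m : ℕ∞) = l := hm.symm.trans hl
  rw [Nat.cast_inj.mp this]

/-- A singular subspace lying between two singular subspaces of dimensions `d - 1` and `d` is one
of them. -/
theorem HasDim.eq_or_eq {X Y Z : Set P} {d : ℤ} (hX : S.HasDim X (d - 1)) (hZ : S.HasDim Z d)
    (hY : S.IsSingular Y) (hXY : X ⊆ Y) (hYZ : Y ⊆ Z) : Y = X ∨ Y = Z := by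
  obtain ⟨hX', m, hm, hdm⟩ := hX
  obtain ⟨hZ', l, hl, hdl⟩ := hZ
  by_contra hne
  rw [not_or] at hne
  have h1 : (⟨X, hX'⟩ : {Y : Set P // S.IsSingular Y}) < ⟨Y, hY⟩ :=
    lt_of_le_of_ne hXY fun h => hne.1 (congrArg Subtype.val h).symm
  have h2 : (⟨Y, hY⟩ : {Y : Set P // S.IsSingular Y}) < ⟨Z, hZ'⟩ :=
    lt_of_le_of_ne hYZ fun h => hne.2 (congrArg Subtype.val h)
  have e1 := Order.height_add_one_le h1
  have e2 := Order.height_add_one_le h2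
  rw [hm] at e1
  rw [hl] at e2
  have e3 : ((m + 1 + 1 : ℕ) : ℕ∞) ≤ (l : ℕ∞) := by
    push_cast
    exact (add_le_add_left e1 1).trans e2
  have e4 : m + 1 + 1 ≤ l := Nat.cast_le.mp e3
  omega

end PartialLinearSpace

/-- A polar space: a partial linear space satisfying the Buekenhout–Shult axioms. -/
structure PolarSpace (P : Type u) extends PartialLinearSpace P where
  /-- (P1) each line contains at least three points -/
  three_points : ∀ L ∈ lines, ∃ a ∈ L, ∃ b ∈ L, ∃ c ∈ L, a ≠ b ∧ a ≠ c ∧ b ≠ c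
  /-- (P2) there is no point collinear to all (other) points -/
  no_radical : ∀ p : P, ∃ q : P, ¬ toPartialLinearSpace.Perp p q
  /-- (P3) a point is collinear to precisely one point or to all points of a line -/
  one_or_all : ∀ p : P, ∀ L ∈ lines,
    (∃! q : P, q ∈ L ∧ toPartialLinearSpace.Perp p q) ∨
      ∀ q ∈ L, toPartialLinearSpace.Perp p q
  /-- (P4) every flag (chain) formed by singular subspaces is finite -/
  finite_flags : ∀ C : Set (Set P), (∀ X ∈ C, toPartialLinearSpace.IsSingular X) →
    IsChain (· ⊆ ·) C → C.Finite

namespace PolarSpace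

open PartialLinearSpace

variable {P : Type u} (Pi : PolarSpace P)

/-- The polar space has rank `n`: the maximal singular subspaces have projective dimension
`n - 1`. -/
def HasRank (n : ℕ) : Prop :=
  ∀ M : Set P, Maximal Pi.IsSingular M → Pi.HasDim M ((n : ℤ) - 1)

/-- The polar Grassmannian of all singular subspaces of projective dimension `k`. -/
def Grassmannian (k : ℕ) : Type u :=
  {X : Set P // Pi.HasDim X (k : ℤ)}

/-- The relation `R_{i,j}` on the polar Grassmannian: `dim (X^⊥ ∩ Y) = k - i` and
`dim (X ∩ Y) = k - j`. -/
def Rel (k i j : ℕ) (X Y : Pi.Grassmannian k) : Prop :=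
  Pi.HasDim (Pi.perp X.1 ∩ Y.1) ((k : ℤ) - i) ∧ Pi.HasDim (X.1 ∩ Y.1) ((k : ℤ) - j)

theorem isSubspace_perp (X : Set P) : Pi.IsSubspace (Pi.perp X) := by
  intro p hp q hq hne L hL hpL hqL r hr x hx
  rcases Pi.one_or_all x L hL with ⟨_, _, hu⟩ | h
  · exact absurd ((hu p ⟨hpL, (hp x hx).symm⟩).trans (hu q ⟨hqL, (hq x hx).symm⟩).symm) hne
  · exact (h r hr).symm

theorem rel_one_one_symm (k : ℕ) {X Y : Pi.Grassmannian k} (h : Pi.Rel k 1 1 X Y) :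
    Pi.Rel k 1 1 Y X := by
  obtain ⟨X, hX⟩ := X
  obtain ⟨Y, hY⟩ := Y
  obtain ⟨h1, h2⟩ := h
  simp only [Nat.cast_one] at h1 h2
  have hXs : Pi.IsSingular X := hX.1
  have hZ : Pi.IsSingular (Pi.perp Y ∩ X) :=
    ⟨(Pi.isSubspace_perp Y).inter hXs.1, fun p hp q hq => hXs.2 p hp.2 q hq.2⟩
  have hsub : X ∩ Y ⊆ Pi.perp Y ∩ X := fun p hp =>
    ⟨fun y hy => hY.1.perp_of_mem hp.2 hy, hp.1⟩
  have key : Pi.HasDim (Pi.perp Y ∩ X) ((k : ℤ) - 1) := by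
    rcases h2.eq_or_eq hX hZ hsub Set.inter_subset_right with e | e
    · rw [e]
      exact h2
    · have : Pi.perp X ∩ Y = Y := Set.inter_eq_right.mpr fun y hy x hx =>
        ((Set.inter_eq_right.mp e hx) y hy).symm
      rw [this] at h1
      have := h1.unique hY
      omega
  refine ⟨?_, ?_⟩
  · simpa using key
  · have h3 : Pi.HasDim (Y ∩ X) ((k : ℤ) - 1) := by
      rw [Set.inter_comm]
      exact h2
    simpa using h3

/-- The graph `Γ'_k` whose vertices are the `k`-dimensional singular subspaces and whose adjacency
relation is `R_{1,1}`. -/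
def graph (k : ℕ) : SimpleGraph (Pi.Grassmannian k) where
  Adj X Y := Pi.Rel k 1 1 X Y
  symm := ⟨fun _ _ h => Pi.rel_one_one_symm k h⟩
  loopless := ⟨fun X h => by
    have h2 := h.2
    rw [Set.inter_self] at h2
    have := h2.unique X.2
    simp at this⟩

end PolarSpace

/-!
The proof is an induction on `k` that descends from `k`-dimensional singular subspaces to points,
where a permutation preserving (non-)collinearity preserves the lines `{p, q}^⊥⊥`.

*Geometry of singular subspaces.* The residue of a singular subspace `S` is studied inside
the degenerate polar space `S^⊥`, whose radical is `S`; no quotient is formed. The join of `S` and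
a point `p` is encoded as `(S ∪ {p})^⊥⊥`, and `exists_mem_radical` shows that it is the union of
the lines from `p` to `S`. This yields `S^⊥⊥ = S` for singular subspaces, the exchange property and
the usual behaviour of dimension (`hasDim_join`, `HasDim.inter`).

*Descent.* Two `k`-dimensional subspaces `X`, `Y` are adjacent if and only if they are spanned by
`S = X ∩ Y`, of dimension `k - 1`, and two non-orthogonal points of `S^⊥`. The relation
`dim (X ∩ Y) = k - 1` alone (`Near`) also allows orthogonal points; it is recognised from the graph
by looking at common neighbours (`near_iff_linked`). For subspaces that have common neighbours but
are not `Near`, `X` and `Y` are opposite lines in the residue of `X ∩ Y`, their common neighbours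
are the transversals, of which there are at least three, and no two transversals are `Near`. In the
orthogonal `Near` case there are two adjacent common neighbours, except in certain grids. If `X`
and `Y` are adjacent, the subspaces containing `X ∩ Y` are those that are equal or `Near` to both, so
an automorphism `f` of `Γ'_k` induces a bijection of the `(k-1)`-dimensional subspaces preserving
inclusion in the `k`-dimensional ones (`exists_equiv_hyperplane`). Finally, adjacency in `Γ'_{k-1}`
is described by this incidence relation (`graph_adj_iff_weaklyJoined`), so the bijection is
an automorphism of `Γ'_{k-1}` and the induction applies.
-/

namespace PolarSpace

open PartialLinearSpace

variable {P : Type u} {Pi : PolarSpace P}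

/-! ### Points, lines and orthogonality -/

theorem perp_refl (p : P) : Pi.Perp p p := Or.inl rfl

theorem mem_line_perp {L : Set P} (hL : L ∈ Pi.lines) {p q : P} (hp : p ∈ L) (hq : q ∈ L) :
    Pi.Perp p q := by
  by_cases h : p = q
  · exact Or.inl h
  · exact Or.inr ⟨h, L, hL, hp, hq⟩

theorem exists_line {p q : P} (h : Pi.Perp p q) (hne : p ≠ q) :
    ∃ L ∈ Pi.lines, p ∈ L ∧ q ∈ L := by
  rcases h with h | h
  · exact absurd h hne
  · exact h.2

theorem perp_of_mem_line {L : Set P} (hL : L ∈ Pi.lines) {x p q r : P} (hp : p ∈ L) (hq : q ∈ L)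
    (hr : r ∈ L) (hne : p ≠ q) (hxp : Pi.Perp x p) (hxq : Pi.Perp x q) : Pi.Perp x r := by
  rcases Pi.one_or_all x L hL with ⟨_, _, hu⟩ | h
  · exact absurd ((hu p ⟨hp, hxp⟩).trans (hu q ⟨hq, hxq⟩).symm) hne
  · exact h r hr

theorem exists_mem_line_perp {L : Set P} (hL : L ∈ Pi.lines) (x : P) :
    ∃ q ∈ L, Pi.Perp x q := by
  rcases Pi.one_or_all x L hL with ⟨q, h, _⟩ | h
  · exact ⟨q, h⟩
  · obtain ⟨a, ha, _⟩ := Pi.three_points L hL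
    exact ⟨a, ha, h a ha⟩

theorem exists_third_point {L : Set P} (hL : L ∈ Pi.lines) (a b : P) :
    ∃ c ∈ L, c ≠ a ∧ c ≠ b := by
  obtain ⟨x, hx, y, hy, z, hz, hxy, hxz, hyz⟩ := Pi.three_points L hL
  grind

theorem subset_perp_perp (X : Set P) : X ⊆ Pi.perp (Pi.perp X) :=
  fun _ hx _ hy => (hy _ hx).symm

theorem perp_anti {X Y : Set P} (h : X ⊆ Y) : Pi.perp Y ⊆ Pi.perp X :=
  fun _ hp x hx => hp x (h hx)

theorem perp_perp_perp (X : Set P) : Pi.perp (Pi.perp (Pi.perp X)) = Pi.perp X :=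
  (perp_anti (subset_perp_perp X)).antisymm (subset_perp_perp _)

theorem mem_perp_insert {S : Set P} {p z : P} :
    z ∈ Pi.perp (insert p S) ↔ Pi.Perp z p ∧ z ∈ Pi.perp S := by
  constructor
  · exact fun h => ⟨h p (Set.mem_insert _ _), fun s hs => h s (Set.mem_insert_of_mem _ hs)⟩
  · rintro ⟨h1, h2⟩ s (rfl | hs)
    · exact h1
    · exact h2 s hs

theorem _root_.PartialLinearSpace.IsSingular.subset_perp {X : Set P} (h : Pi.IsSingular X) :
    X ⊆ Pi.perp X :=
  fun _ hp _ hq => h.perp_of_mem hp hq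

theorem isSingular_of {X : Set P} (h : Pi.IsSubspace X) (h' : X ⊆ Pi.perp X) :
    Pi.IsSingular X :=
  ⟨h, fun _ hp q hq hne => (h' hp q hq).resolve_left hne⟩

theorem _root_.PartialLinearSpace.IsSingular.inter {X Y : Set P} (hX : Pi.IsSingular X)
    (hY : Pi.IsSingular Y) : Pi.IsSingular (X ∩ Y) :=
  ⟨hX.1.inter hY.1, fun p hp q hq => hX.2 p hp.1 q hq.1⟩

/-- The join of a singular subspace `S` and a point `p` orthogonal to it, encoded as the double
orthogonal complement of `S ∪ {p}`. -/
def join (Pi : PolarSpace P) (S : Set P) (p : P) : Set P :=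
  Pi.perp (Pi.perp (insert p S))

theorem mem_join_self (S : Set P) (p : P) : p ∈ Pi.join S p :=
  subset_perp_perp _ (Set.mem_insert _ _)

theorem subset_join (S : Set P) (p : P) : S ⊆ Pi.join S p :=
  (Set.subset_insert _ _).trans (subset_perp_perp _)

theorem isSubspace_join (S : Set P) (p : P) : Pi.IsSubspace (Pi.join S p) :=
  Pi.isSubspace_perp _

theorem mem_join_perp {S : Set P} {p c z : P} (hc : c ∈ Pi.join S p) (hz : z ∈ Pi.perp S)
    (hzp : Pi.Perp z p) : Pi.Perp z c :=
  (hc z (mem_perp_insert.2 ⟨hzp, hz⟩)).symm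

/-- Points outside the join of `S` and `p` are separated from it by a point of `S^⊥`. -/
theorem exists_perp_not_perp {S : Set P} {p c : P} (hc : c ∉ Pi.join S p) :
    ∃ z ∈ Pi.perp S, Pi.Perp z p ∧ ¬ Pi.Perp z c := by
  by_contra! h
  exact hc fun z hz => (h z (mem_perp_insert.1 hz).2 (mem_perp_insert.1 hz).1).symm

theorem isSingular_join {S : Set P} {p : P} (hS : Pi.IsSingular S) (hp : p ∈ Pi.perp S) :
    Pi.IsSingular (Pi.join S p) := by
  refine isSingular_of (isSubspace_join S p) (perp_anti ?_)
  have h1 : insert p S ⊆ Pi.perp (insert p S) := by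
    rintro x (rfl | hx)
    · exact mem_perp_insert.2 ⟨perp_refl _, hp⟩
    · exact mem_perp_insert.2 ⟨(hp x hx).symm, hS.subset_perp hx⟩
  intro x hx z hz
  exact hx z (h1 hz)

/-- If `p^⊥ ⊆ c^⊥` inside a subspace `T`, then some point of the line `pc` lies in the radical
of `T`. Applied to `T = S^⊥`, whose radical is `S`, it shows that joins are unions of lines. -/
theorem exists_mem_radical {T : Set P} (hT : Pi.IsSubspace T) {p c : P} (hp : p ∈ T) (hc : c ∈ T)
    (hne : p ≠ c) (h : ∀ z ∈ T, Pi.Perp z p → Pi.Perp z c) :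
    ∃ L ∈ Pi.lines, p ∈ L ∧ c ∈ L ∧ ∃ y ∈ L, y ∈ T ∧ ∀ z ∈ T, Pi.Perp y z := by
  obtain ⟨L, hL, hpL, hcL⟩ := exists_line (h p hp (perp_refl p)) hne
  have hLT : L ⊆ T := hT p hp c hc hne L hL hpL hcL
  refine ⟨L, hL, hpL, hcL, ?_⟩
  by_cases hcr : ∀ z ∈ T, Pi.Perp c z
  · exact ⟨c, hcL, hc, hcr⟩
  push Not at hcr
  obtain ⟨v, hv, hvc⟩ := hcr
  replace hvc : ¬ Pi.Perp v c := fun h => hvc h.symm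
  obtain ⟨y, hyL, hvy⟩ := exists_mem_line_perp hL v
  -- A point `z` orthogonal to some `a ⊥ y` with `a` not orthogonal to `c` is orthogonal to `y`:
  -- the point of the line `za` orthogonal to `p` is orthogonal to `c`, hence to `y`.
  have key : ∀ z ∈ T, ∀ a ∈ T, Pi.Perp a y → ¬ Pi.Perp a c → Pi.Perp z a → Pi.Perp y z := by
    intro z hz a ha hay hac hza
    by_cases e : z = a
    · exact e ▸ hay.symm
    obtain ⟨M, hM, hzM, haM⟩ := exists_line hza e
    obtain ⟨b, hbM, hpb⟩ := exists_mem_line_perp hM p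
    have hbT : b ∈ T := hT z hz a ha e M hM hzM haM hbM
    have hbc : Pi.Perp b c := h b hbT hpb.symm
    have hby : Pi.Perp b y := perp_of_mem_line hL hpL hcL hyL hne hpb.symm hbc
    have hab : a ≠ b := fun e => hac (e ▸ hbc)
    exact perp_of_mem_line hM haM hbM hzM hab hay.symm hby.symm
  refine ⟨y, hyL, hLT hyL, fun z hz => ?_⟩
  by_cases hzv : Pi.Perp z v
  · exact key z hz v hv hvy hvc hzv
  have hyc : Pi.Perp y c := mem_line_perp hL hyL hcL
  have hvy' : v ≠ y := fun e => hvc (e ▸ hyc)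
  obtain ⟨M, hM, hvM, hyM⟩ := exists_line hvy hvy'
  obtain ⟨a, haM, hza⟩ := exists_mem_line_perp hM z
  by_cases e : a = y
  · exact e ▸ hza.symm
  refine key z hz a (hT v hv y (hLT hyL) hvy' M hM hvM hyM haM) (mem_line_perp hM haM hyM) ?_ hza
  intro hac
  exact hvc (perp_of_mem_line hM haM hyM hvM e hac.symm hyc.symm).symm

/-! ### Singular subspaces are projective spaces -/

/-- The hypothesis `hcl` holds for every singular subspace, but the proof of this uses the lemma. -/
theorem mem_join_of_closed {S : Set P} (hS : Pi.IsSingular S) (hcl : Pi.perp (Pi.perp S) = S)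
    {p c : P} (hp : p ∈ Pi.perp S) (hc : c ∈ Pi.join S p) (hne : p ≠ c) :
    ∃ L ∈ Pi.lines, p ∈ L ∧ c ∈ L ∧ ∃ s ∈ L, s ∈ S := by
  have hcS : c ∈ Pi.perp S := fun s hs =>
    (mem_join_perp hc (hS.subset_perp hs) (hp s hs).symm).symm
  obtain ⟨L, hL, hpL, hcL, y, hyL, _, hy⟩ := exists_mem_radical (Pi.isSubspace_perp S) hp hcS hne
    fun z hz hzp => mem_join_perp hc hz hzp
  exact ⟨L, hL, hpL, hcL, y, hyL, hcl ▸ hy⟩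

/-- By finiteness of flags, a property of singular subspaces has maximal witnesses. -/
theorem exists_maximal_singular {Q : Set P → Prop} (hQ : ∀ X, Q X → Pi.IsSingular X) {X : Set P}
    (hX : Q X) : ∃ M, X ⊆ M ∧ Maximal Q M := by
  refine zorn_subset_nonempty {X | Q X} (fun C hC hchain hne => ?_) X hX
  obtain ⟨m, hm, hmax⟩ :=
    (Pi.finite_flags C (fun X h => hQ X (hC h)) hchain).exists_maximal hne
  refine ⟨m, hC hm, fun s hs => ?_⟩
  rcases hchain.total hs hm with h | h
  · exact h
  · exact hmax hs h

/-- Singular subspaces are closed: a maximal closed subspace of `S` must be `S`, since adding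
a point to it gives a closed subspace again. -/
theorem _root_.PartialLinearSpace.IsSingular.perp_perp {S : Set P} (hS : Pi.IsSingular S) :
    Pi.perp (Pi.perp S) = S := by
  have h0 : Pi.IsSingular (∅ : Set P) ∧ Pi.perp (Pi.perp (∅ : Set P)) = ∅ ∧ (∅ : Set P) ⊆ S := by
    refine ⟨⟨by simp [IsSubspace], by simp⟩, ?_, Set.empty_subset _⟩
    ext p
    obtain ⟨q, hq⟩ := Pi.no_radical p
    simp only [Set.mem_empty_iff_false, iff_false]
    exact fun h => hq (h q fun _ hx => absurd hx (Set.notMem_empty _))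
  obtain ⟨M, -, ⟨hM, hcl, hMS⟩, hmax⟩ := exists_maximal_singular
    (Q := fun Y => Pi.IsSingular Y ∧ Pi.perp (Pi.perp Y) = Y ∧ Y ⊆ S) (fun _ h => h.1) h0
  rcases hMS.eq_or_ssubset with rfl | hss
  · exact hcl
  obtain ⟨p, hpS, hpM⟩ := Set.exists_of_ssubset hss
  have hp : p ∈ Pi.perp M := perp_anti hMS (hS.subset_perp hpS)
  refine absurd (hmax ⟨isSingular_join hM hp, perp_perp_perp _, fun c hc => ?_⟩
    (subset_join M p) (mem_join_self M p)) hpM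
  by_cases e : p = c
  · exact e ▸ hpS
  obtain ⟨L, hL, hpL, hcL, s, hsL, hsM⟩ := mem_join_of_closed hM hcl hp hc e
  exact hS.1 p hpS s (hMS hsM) (fun h => hpM (h ▸ hsM)) L hL hpL hsL hcL

/-- The join of `S` and `p` is the union of the lines joining `p` to the points of `S`. -/
theorem mem_join {S : Set P} (hS : Pi.IsSingular S)
    {p c : P} (hp : p ∈ Pi.perp S) (hc : c ∈ Pi.join S p) (hne : p ≠ c) :
    ∃ L ∈ Pi.lines, p ∈ L ∧ c ∈ L ∧ ∃ s ∈ L, s ∈ S :=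
  mem_join_of_closed hS hS.perp_perp hp hc hne

theorem join_subset {S X : Set P} (hX : Pi.IsSingular X) {p : P} (hSX : S ⊆ X) (hp : p ∈ X) :
    Pi.join S p ⊆ X := by
  rw [← hX.perp_perp]
  exact perp_anti (perp_anti (Set.insert_subset hp hSX))

theorem join_exchange {S : Set P} (hS : Pi.IsSingular S) {p c : P} (hp : p ∈ Pi.perp S)
    (hc : c ∈ Pi.join S p) (hcS : c ∉ S) : Pi.join S c = Pi.join S p := by
  have hcS' : c ∈ Pi.perp S := perp_anti (subset_join S p)
    ((isSingular_join hS hp).subset_perp hc)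
  refine (join_subset (isSingular_join hS hp) (subset_join S p) hc).antisymm
    (join_subset (isSingular_join hS hcS') (subset_join S c) ?_)
  by_cases e : p = c
  · exact e ▸ mem_join_self S p
  obtain ⟨L, hL, hpL, hcL, s, hsL, hs⟩ := mem_join hS hp hc e
  exact isSubspace_join S c c (mem_join_self S c) s (subset_join S c hs) (fun h => hcS (h ▸ hs))
    L hL hcL hsL hpL

/-- If `Z` lies in the join of `Y` and a point `z` of `Z`, then `Z` is spanned by `Y ∩ Z` and `z`:
every line of `Z` through `z` meets `Y`. -/
theorem join_inter {Y Z : Set P} (hY : Pi.IsSingular Y) (hZ : Pi.IsSingular Z) {z : P}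
    (hzZ : z ∈ Z) (hzY : z ∈ Pi.perp Y) (hZX : Z ⊆ Pi.join Y z) :
    Z = Pi.join (Y ∩ Z) z := by
  refine Set.Subset.antisymm (fun w hw => ?_) (join_subset hZ Set.inter_subset_right hzZ)
  by_cases e : z = w
  · exact e ▸ mem_join_self _ _
  obtain ⟨L, hL, hzL, hwL, s, hsL, hs⟩ := mem_join hY hzY (hZX hw) e
  by_cases e' : z = s
  · subst e'
    exact subset_join (Y ∩ Z) z ⟨join_subset hY le_rfl hs (hZX hw), hw⟩
  have hsZ : s ∈ Z := hZ.1 z hzZ w hw e L hL hzL hwL hsL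
  exact isSubspace_join _ _ z (mem_join_self _ _) s (subset_join (Y ∩ Z) z ⟨hs, hsZ⟩) e'
    L hL hzL hsL hwL

/-! ### Dimension -/

theorem _root_.PartialLinearSpace.HasDim.isSingular {X : Set P} {d : ℤ} (h : Pi.HasDim X d) :
    Pi.IsSingular X := h.1

theorem exists_hasDim {n : ℕ} (hr : Pi.HasRank n) {X : Set P} (hX : Pi.IsSingular X) :
    ∃ d, Pi.HasDim X d ∧ -1 ≤ d := by
  obtain ⟨M, hXM, hM⟩ := exists_maximal_singular (fun _ h => h) hX
  obtain ⟨hM', m, hm, -⟩ := hr M hM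
  have h1 : Order.height (⟨X, hX⟩ : {Y : Set P // Pi.IsSingular Y}) ≤ (m : ℕ∞) := by
    rw [← hm]
    exact Order.height_mono (show (⟨X, hX⟩ : {Y : Set P // Pi.IsSingular Y}) ≤ ⟨M, hM'⟩ from hXM)
  obtain ⟨l, hl⟩ := ENat.ne_top_iff_exists.1 (ne_top_of_le_ne_top (ENat.natCast_ne_top m) h1)
  exact ⟨(l : ℤ) - 1, ⟨hX, l, hl.symm, rfl⟩, by omega⟩

theorem _root_.PartialLinearSpace.HasDim.lt {X Y : Set P} {d e : ℤ} (hX : Pi.HasDim X d)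
    (hY : Pi.HasDim Y e) (h : X ⊂ Y) : d < e := by
  obtain ⟨hX', m, hm, rfl⟩ := hX
  obtain ⟨hY', l, hl, rfl⟩ := hY
  have h1 : (⟨X, hX'⟩ : {Y : Set P // Pi.IsSingular Y}) < ⟨Y, hY'⟩ := h
  have h2 := Order.height_add_one_le h1
  rw [hm, hl] at h2
  have : m + 1 ≤ l := by exact_mod_cast h2
  omega

theorem _root_.PartialLinearSpace.HasDim.le {X Y : Set P} {d e : ℤ} (hX : Pi.HasDim X d)
    (hY : Pi.HasDim Y e) (h : X ⊆ Y) : d ≤ e := by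
  rcases h.eq_or_ssubset with rfl | h
  · exact (hX.unique hY).le
  · exact (hX.lt hY h).le

theorem _root_.PartialLinearSpace.HasDim.eq_of_subset {X Y : Set P} {d : ℤ} (hX : Pi.HasDim X d)
    (hY : Pi.HasDim Y d) (h : X ⊆ Y) : X = Y := by
  rcases h.eq_or_ssubset with h | h
  · exact h
  · exact absurd (hX.lt hY h) (lt_irrefl _)

/-- The Jordan–Dedekind property: adding a point to a subspace raises its dimension by one. Two
hyperplanes of a singular subspace meet in a hyperplane of both, which allows induction on
the dimension of the larger space. -/
theorem hasDim_of_hasDim_join {n : ℕ} (hr : Pi.HasRank n) (N : ℕ) : ∀ {Y : Set P} {p : P} {d : ℤ},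
    Pi.IsSingular Y → p ∈ Pi.perp Y → p ∉ Y → Pi.HasDim (Pi.join Y p) d → d + 1 = N →
    Pi.HasDim Y (d - 1) := by
  induction N using Nat.strong_induction_on with
  | _ N ih =>
  intro Y p d hY hp hpY hd hN
  have hXs := hd.isSingular
  obtain ⟨e, hYe, he⟩ := exists_hasDim hr hY
  have hYX : Y ⊂ Pi.join Y p := (subset_join Y p).ssubset_of_mem_notMem (mem_join_self Y p) hpY
  have hlt := hYe.lt hd hYX
  -- The last step of a chain of maximal length.
  obtain ⟨Z, hZ, hZX⟩ : ∃ Z, Pi.HasDim Z (d - 1) ∧ Z ⊂ Pi.join Y p := by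
    obtain ⟨h1, m, hm, rfl⟩ := hd
    obtain ⟨s, hs, hl⟩ := Order.exists_series_of_height_eq_coe _ hm
    have hm0 : m ≠ 0 := by omega
    have h2 := Order.height_eq_index_of_length_eq_height_last (p := s) (by rw [hs, hm, hl])
      ⟨m - 1, by omega⟩
    refine ⟨(s ⟨m - 1, by omega⟩).1, ⟨(s ⟨m - 1, by omega⟩).2, m - 1, h2, by omega⟩, ?_⟩
    have h3 : s ⟨m - 1, by omega⟩ < s (Fin.last _) := s.strictMono (by
      rw [Fin.lt_def]; simp; omega)
    change s ⟨m - 1, by omega⟩ < ⟨Pi.join Y p, h1⟩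
    rw [← hs]
    exact h3
  have hZs := hZ.isSingular
  by_cases hYZ : Y ⊆ Z
  · rcases hYZ.eq_or_ssubset with rfl | h
    · exact hZ
    · obtain ⟨z, hz, hzY⟩ := Set.exists_of_ssubset h
      have := join_exchange hY hp (hZX.1 hz) hzY
      exact absurd (this ▸ join_subset hZs hYZ hz) hZX.2
  by_cases hZY : Z ⊆ Y
  · have := hZ.le hYe hZY
    obtain rfl : e = d - 1 := by omega
    exact hYe
  obtain ⟨y, hyY, hyZ⟩ := Set.not_subset.1 hYZ
  obtain ⟨z, hzZ, hzY⟩ := Set.not_subset.1 hZY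
  have hyX : y ∈ Pi.join Y p := hYX.1 hyY
  have hzX : z ∈ Pi.join Y p := hZX.1 hzZ
  have hyZ' : y ∈ Pi.perp Z := perp_anti hZX.1 (hXs.subset_perp hyX)
  have hzY' : z ∈ Pi.perp Y := perp_anti hYX.1 (hXs.subset_perp hzX)
  have e1 : Z = Pi.join (Y ∩ Z) z :=
    join_inter hY hZs hzZ hzY' (join_exchange hY hp hzX hzY ▸ hZX.1)
  have e2 : Pi.join Z y = Pi.join Y p := by
    have hs := join_subset hXs hZX.1 hyX
    obtain ⟨e', he', -⟩ := exists_hasDim hr (isSingular_join hZs hyZ')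
    have h1 := hZ.lt he' ((subset_join Z y).ssubset_of_mem_notMem (mem_join_self Z y) hyZ)
    have h2 := he'.le hd hs
    obtain rfl : e' = d := by omega
    exact he'.eq_of_subset hd hs
  have e3 : Y = Pi.join (Z ∩ Y) y := join_inter hZs hY hyY hyZ' (e2 ▸ hYX.1)
  have hI := hY.inter hZs
  have h1 : Pi.HasDim (Y ∩ Z) (d - 1 - 1) :=
    ih (N - 1) (by omega) hI (perp_anti Set.inter_subset_left hzY') (fun h => hzY h.1)
      (e1 ▸ hZ) (by omega)
  have h2 : Pi.HasDim (Y ∩ Z) (e - 1) := by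
    refine ih (e + 1).toNat (by omega) hI (perp_anti Set.inter_subset_right hyZ')
      (fun h => hyZ h.2) ?_ (by omega)
    rw [Set.inter_comm, ← e3]
    exact hYe
  have := h1.unique h2
  obtain rfl : e = d - 1 := by omega
  exact hYe

theorem hasDim_join {n : ℕ} (hr : Pi.HasRank n) {S : Set P} {p : P} {d : ℤ} (hS : Pi.HasDim S d)
    (hp : p ∈ Pi.perp S) (hpS : p ∉ S) : Pi.HasDim (Pi.join S p) (d + 1) := by
  obtain ⟨e, he, he'⟩ := exists_hasDim hr (isSingular_join hS.isSingular hp)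
  have := hasDim_of_hasDim_join hr (e + 1).toNat hS.isSingular hp hpS he (by omega)
  obtain rfl : e = d + 1 := by
    have := this.unique hS
    omega
  exact he

/-- A singular subspace is spanned by a hyperplane and any point outside. -/
theorem _root_.PartialLinearSpace.HasDim.join_eq {n : ℕ} (hr : Pi.HasRank n) {S X : Set P}
    {x : P} {d : ℤ} (hS : Pi.HasDim S (d - 1)) (hX : Pi.HasDim X d) (hSX : S ⊆ X) (hx : x ∈ X)
    (hxS : x ∉ S) :
    Pi.join S x = X := by
  have h := hasDim_join hr hS (perp_anti hSX (hX.isSingular.subset_perp hx)) hxS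
  rw [sub_add_cancel] at h
  exact h.eq_of_subset hX (join_subset hX.isSingular hSX hx)

theorem _root_.PartialLinearSpace.HasDim.exists_notMem {X Y : Set P} {d e : ℤ}
    (hX : Pi.HasDim X d) (hY : Pi.HasDim Y e) (h : d ≤ e) (hne : X ≠ Y) : ∃ y ∈ Y, y ∉ X := by
  by_contra! hs
  have h1 := hY.lt hX (lt_of_le_of_ne hs (Ne.symm hne))
  omega

theorem _root_.PartialLinearSpace.HasDim.inter {n : ℕ} (hr : Pi.HasRank n) {X Y Z : Set P} {d : ℤ}
    (hX : Pi.HasDim X d) (hY : Pi.HasDim Y (d - 1)) (hZ : Pi.HasDim Z (d - 1)) (hYX : Y ⊆ X)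
    (hZX : Z ⊆ X) (hne : Y ≠ Z) : Pi.HasDim (Y ∩ Z) (d - 1 - 1) := by
  obtain ⟨z, hzZ, hzY⟩ := hY.exists_notMem hZ le_rfl hne
  have hz : z ∈ Pi.perp Y := perp_anti hYX (hX.isSingular.subset_perp (hZX hzZ))
  have e := join_inter hY.isSingular hZ.isSingular hzZ hz
    (by rw [hY.join_eq hr hX hYX (hZX hzZ) hzY]; exact hZX)
  obtain ⟨c, hc, -⟩ := exists_hasDim hr (hY.isSingular.inter hZ.isSingular)
  have h := hasDim_join hr hc (perp_anti Set.inter_subset_left hz) (fun h => hzY h.1)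
  rw [← e] at h
  have := h.unique hZ
  obtain rfl : c = d - 1 - 1 := by omega
  exact hc

theorem _root_.PartialLinearSpace.HasDim.exists_between {n : ℕ} (hr : Pi.HasRank n)
    {X Y : Set P} (m : ℕ) :
    ∀ {c d : ℤ}, Pi.HasDim Y c → Pi.HasDim X d → Y ⊆ X → c + m ≤ d →
    ∃ Z, Pi.HasDim Z (c + m) ∧ Y ⊆ Z ∧ Z ⊆ X := by
  induction m with
  | zero => exact fun hY _ h _ => ⟨Y, by simpa using hY, le_rfl, h⟩
  | succ m ih =>
    intro c d hY hX h hle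
    push_cast at hle
    obtain ⟨Z, hZ, hYZ, hZX⟩ := ih hY hX h (by omega)
    obtain ⟨x, hx, hxZ⟩ := hZ.exists_notMem hX (by omega)
      (fun e => by have := (e ▸ hZ).unique hX; omega)
    refine ⟨Pi.join Z x, ?_, hYZ.trans (subset_join _ _), join_subset hX.isSingular hZX hx⟩
    have := hasDim_join hr hZ (perp_anti hZX (hX.isSingular.subset_perp hx)) hxZ
    push_cast
    rwa [← add_assoc]

/-- A singular subspace that is not of the top dimension can be enlarged. -/
theorem _root_.PartialLinearSpace.HasDim.exists_mem_perp {n : ℕ} (hr : Pi.HasRank n) {X : Set P}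
    {d : ℤ} (hX : Pi.HasDim X d) (hd : d + 2 ≤ n) : ∃ x ∈ Pi.perp X, x ∉ X := by
  obtain ⟨M, hXM, hM⟩ := exists_maximal_singular (fun _ h => h) hX.isSingular
  have hMd := hr M hM
  obtain ⟨x, hx, hxX⟩ := hX.exists_notMem hMd (by omega)
    (fun e => by have := (e ▸ hX).unique hMd; omega)
  exact ⟨x, perp_anti hXM (hM.1.subset_perp hx), hxX⟩

theorem hasDim_empty {n : ℕ} (hr : Pi.HasRank n) : Pi.HasDim (∅ : Set P) (-1) := by
  have h : Pi.IsSingular (∅ : Set P) := ⟨by simp [IsSubspace], by simp⟩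
  obtain ⟨d, hd, h1⟩ := exists_hasDim hr h
  have : d = -1 := by
    obtain ⟨_, m, hm, rfl⟩ := hd
    have h0 : Order.height (⟨∅, h⟩ : {Y : Set P // Pi.IsSingular Y}) = 0 :=
      Order.height_eq_zero.2 fun b _ => Set.empty_subset _
    rw [hm] at h0
    have : m = 0 := by exact_mod_cast h0
    omega
  exact this ▸ hd

/-! ### Non-orthogonal points in a residue -/

theorem join_subset_perp {S B : Set P} {b : P} (hS : S ⊆ Pi.perp B)
    (hb : b ∈ Pi.perp B) :
    Pi.join S b ⊆ Pi.perp B := by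
  rw [← perp_perp_perp B]
  exact perp_anti (perp_anti (Set.insert_subset hb hS))

theorem subset_perp_symm {X Y : Set P} (h : X ⊆ Pi.perp Y) : Y ⊆ Pi.perp X :=
  fun y hy _ hx => (h hx y hy).symm

theorem mem_perp_join {S : Set P} {p z : P} :
    z ∈ Pi.perp (Pi.join S p) ↔ Pi.Perp z p ∧ z ∈ Pi.perp S := by
  rw [join, perp_perp_perp, mem_perp_insert]

/-- A point of `S^⊥` whose only neighbour on the line `L` is the prescribed point `z`. -/
theorem exists_perp_only {S L : Set P} (hS : Pi.IsSingular S) (hL : L ∈ Pi.lines)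
    (hLS : L ⊆ Pi.perp S) (hd : ∀ s ∈ L, s ∉ S) {x z : P} (hx : x ∈ L) (hz : z ∈ L)
    (hxz : x ≠ z) : ∃ p ∈ Pi.perp S, Pi.Perp p z ∧ ∀ t ∈ L, t ≠ z → ¬ Pi.Perp p t := by
  have h : x ∉ Pi.join S z := by
    intro h
    obtain ⟨M, hM, hzM, hxM, s, hsM, hs⟩ := mem_join hS (hLS hz) h hxz.symm
    have e := Pi.line_unique x z hxz M hM L hL hxM hzM hx hz
    exact hd s (e ▸ hsM) hs
  obtain ⟨p, hp, hpz, hpx⟩ := exists_perp_not_perp h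
  exact ⟨p, hp, hpz, fun t ht hne hpt => hpx (perp_of_mem_line hL ht hz hx hne hpt hpz)⟩

/-- If the line `L` has at least four points `x, y, z, z'`, then some two non-orthogonal points are
both orthogonal to neither `x` nor `y`. -/
theorem exists_pair_of_four_points {S L : Set P} (hS : Pi.IsSingular S) (hL : L ∈ Pi.lines)
    (hLS : L ⊆ Pi.perp S) (hd : ∀ s ∈ L, s ∉ S) {x y z z' : P} (hx : x ∈ L) (hy : y ∈ L)
    (hz : z ∈ L) (hz' : z' ∈ L) (hxz : x ≠ z) (hyz : y ≠ z) (hxz' : x ≠ z') (hyz' : y ≠ z')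
    (hzz' : z ≠ z') :
    ∃ w ∈ Pi.perp S, ∃ w' ∈ Pi.perp S, ¬ Pi.Perp w x ∧ ¬ Pi.Perp w y ∧ ¬ Pi.Perp w' x ∧
      ¬ Pi.Perp w' y ∧ ¬ Pi.Perp w w' := by
  obtain ⟨p, hp, -, hpL⟩ := exists_perp_only hS hL hLS hd hx hz hxz
  obtain ⟨v, hv, hvz', hvL⟩ := exists_perp_only hS hL hLS hd hx hz' hxz'
  have hpz' := hpL z' hz' hzz'.symm
  by_cases hpv : Pi.Perp p v
  · have hne : v ≠ z' := fun e => hpz' (e ▸ hpv)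
    obtain ⟨M, hM, hvM, hzM⟩ := exists_line hvz' hne
    obtain ⟨q, hqM, hqv, hqz⟩ := exists_third_point hM v z'
    have hqT : q ∈ Pi.perp S := Pi.isSubspace_perp S v hv z' (hLS hz') hne M hM hvM hzM hqM
    have hq : ∀ t ∈ L, t ≠ z' → ¬ Pi.Perp q t := fun t ht hne' hqt =>
      hvL t ht hne' (perp_of_mem_line hM hqM hzM hvM hqz hqt.symm (mem_line_perp hL ht hz')).symm
    exact ⟨p, hp, q, hqT, hpL x hx hxz, hpL y hy hyz, hq x hx hxz', hq y hy hyz',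
      fun h => hpz' (perp_of_mem_line hM hvM hqM hzM hqv.symm hpv h)⟩
  · exact ⟨p, hp, v, hv, hpL x hx hxz, hpL y hy hyz, hvL x hx hxz', hvL y hy hyz', hpv⟩

/-- Two non-orthogonal points `x`, `p` of the residue of `Z` have a common non-orthogonal point as
soon as there is a line of the residue through `p`. -/
theorem exists_not_perp_not_perp {Z : Set P} (hZ : Pi.IsSingular Z) {x p q : P}
    (hx : x ∈ Pi.perp Z) (hp : p ∈ Pi.perp Z) (hq : q ∈ Pi.perp Z) (hxp : ¬ Pi.Perp x p)
    (hpq : Pi.Perp p q) (hqp : q ∉ Pi.join Z p) :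
    ∃ w ∈ Pi.perp Z, ¬ Pi.Perp w x ∧ ¬ Pi.Perp w p := by
  have hpZ : p ∉ Z := fun h => hxp (hx p h)
  have hxZ : x ∉ Z := fun h => hxp (hp x h).symm
  -- A point `w` not orthogonal to `p` can be moved off `x^⊥` unless `w` and `x` coincide in
  -- the residue.
  have inner : ∀ w ∈ Pi.perp Z, ¬ Pi.Perp w p → x ∉ Pi.join Z w →
      ∃ w ∈ Pi.perp Z, ¬ Pi.Perp w x ∧ ¬ Pi.Perp w p := by
    intro w hw hwp hxw
    by_cases hwx : Pi.Perp w x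
    swap
    · exact ⟨w, hw, hwx, hwp⟩
    obtain ⟨u, hu, huw, hux⟩ := exists_perp_not_perp hxw
    by_cases hup : Pi.Perp u p
    swap
    · exact ⟨u, hu, hux, hup⟩
    have hne : u ≠ w := fun e => hux (e ▸ hwx)
    obtain ⟨M, hM, huM, hwM⟩ := exists_line huw hne
    obtain ⟨t, htM, htu, htw⟩ := exists_third_point hM u w
    exact ⟨t, Pi.isSubspace_perp Z u hu w hw hne M hM huM hwM htM,
      fun h => hux (perp_of_mem_line hM htM hwM huM htw h.symm hwx.symm).symm,
      fun h => hwp (perp_of_mem_line hM htM huM hwM htu h.symm hup.symm).symm⟩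
  have hpq' : p ≠ q := fun e => hqp (e ▸ mem_join_self Z p)
  obtain ⟨L, hL, hpL, hqL⟩ := exists_line hpq hpq'
  obtain ⟨r, hrL, hxr⟩ := exists_mem_line_perp hL x
  have hrp : p ≠ r := fun e => hxp (e ▸ hxr)
  have hrT : r ∈ Pi.perp Z := Pi.isSubspace_perp Z p hp q hq hpq' L hL hpL hqL hrL
  have hpr : Pi.Perp p r := mem_line_perp hL hpL hrL
  have hr : r ∉ Pi.join Z p := fun h =>
    hqp (isSubspace_join Z p p (mem_join_self Z p) r h hrp L hL hpL hrL hqL)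
  have hrZ : r ∉ Z := fun h => hr (subset_join Z p h)
  have hpr' : p ∉ Pi.join Z r := fun h =>
    hr ((join_exchange hZ hrT h hpZ).symm ▸ mem_join_self Z r)
  obtain ⟨w, hw, hwr, hwp⟩ := exists_perp_not_perp hpr'
  by_cases hxw : x ∈ Pi.join Z w
  swap
  · exact inner w hw hwp hxw
  have hne : w ≠ r := fun e => hwp (e ▸ hpr.symm)
  obtain ⟨M, hM, hwM, hrM⟩ := exists_line hwr hne
  obtain ⟨w', hw'M, hw'w, hw'r⟩ := exists_third_point hM w r
  have hw' : w' ∈ Pi.perp Z := Pi.isSubspace_perp Z w hw r hrT hne M hM hwM hrM hw'M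
  -- If `w` and `x` coincide in the residue, another point of the line `wr` does the job.
  refine inner w' hw' (fun h => hwp
    (perp_of_mem_line hM hw'M hrM hwM hw'r h.symm hpr).symm) fun hxw' => ?_
  have e1 := join_exchange hZ hw hxw hxZ
  have e2 := join_exchange hZ hw' hxw' hxZ
  have h1 : w ∈ Pi.join Z x := e1 ▸ mem_join_self Z w
  have h2 : w' ∈ Pi.join Z x := e2 ▸ mem_join_self Z w'
  have h3 : r ∈ Pi.join Z x := isSubspace_join Z x w h1 w' h2 hw'w.symm M hM hwM hw'M hrM
  have e3 := join_exchange hZ hx h3 hrZ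
  have h4 : x ∈ Pi.join Z r := e3 ▸ mem_join_self Z x
  exact hxp (mem_join_perp h4 hp hpr).symm

/-! ### Subspaces meeting in a hyperplane -/

section
variable {k : ℕ}

/-- Two `k`-dimensional singular subspaces meet in a common hyperplane. -/
def Near (X Y : Pi.Grassmannian k) : Prop :=
  Pi.HasDim (X.1 ∩ Y.1) ((k : ℤ) - 1)

theorem Near.symm {X Y : Pi.Grassmannian k} (h : Near X Y) : Near Y X := by
  rwa [Near, Set.inter_comm]

theorem Near.ne {X Y : Pi.Grassmannian k} (h : Near X Y) : X ≠ Y := by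
  rintro rfl
  rw [Near, Set.inter_self] at h
  have := h.unique X.2
  omega

theorem eq_of_subset {X Y : Pi.Grassmannian k} (h : X.1 ⊆ Y.1) : X = Y :=
  Subtype.ext (X.2.eq_of_subset Y.2 h)

theorem inter_eq_of_subset {X Y : Pi.Grassmannian k} {S : Set P}
    (hS : Pi.HasDim S ((k : ℤ) - 1)) (hSX : S ⊆ X.1) (hSY : S ⊆ Y.1) (hne : X ≠ Y) :
    X.1 ∩ Y.1 = S := by
  rcases hS.eq_or_eq X.2 (X.2.isSingular.inter Y.2.isSingular) (Set.subset_inter hSX hSY)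
    Set.inter_subset_left with h | h
  · exact h
  · exact absurd (eq_of_subset (Set.inter_eq_left.1 h)) hne

theorem near_of_subset {X Y : Pi.Grassmannian k} {S : Set P}
    (hS : Pi.HasDim S ((k : ℤ) - 1)) (hSX : S ⊆ X.1) (hSY : S ⊆ Y.1) (hne : X ≠ Y) :
    Near X Y := by
  rw [Near, inter_eq_of_subset hS hSX hSY hne]
  exact hS

theorem Near.exists_left {X Y : Pi.Grassmannian k} (h : Near X Y) : ∃ x ∈ X.1, x ∉ Y.1 := by
  by_contra! hs
  exact h.ne (eq_of_subset hs)

theorem graph_adj_iff {X Y : Pi.Grassmannian k} :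
    (Pi.graph k).Adj X Y ↔ Near X Y ∧ ¬ Y.1 ⊆ Pi.perp X.1 := by
  change (_ ∧ _) ↔ _
  simp only [Nat.cast_one]
  constructor
  · rintro ⟨h1, h2⟩
    refine ⟨h2, fun h => ?_⟩
    rw [Set.inter_eq_right.2 h] at h1
    have := h1.unique Y.2
    omega
  · rintro ⟨h1, h2⟩
    refine ⟨?_, h1⟩
    have h1' : Pi.HasDim (X.1 ∩ Y.1) ((k : ℤ) - 1) := h1
    rcases h1'.eq_or_eq Y.2 (Y := Pi.perp X.1 ∩ Y.1)
      ⟨(Pi.isSubspace_perp _).inter Y.2.1.1, fun p hp q hq => Y.2.1.2 p hp.2 q hq.2⟩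
      (Set.inter_subset_inter_left _ X.2.isSingular.subset_perp) Set.inter_subset_right with e | e
    · rw [e]
      exact h1
    · exact absurd (Set.inter_eq_right.1 e) h2

variable {n : ℕ}

/-- Adjacency is non-orthogonality of points in the residue of `S`. -/
theorem graph_adj_iff_not_perp (hr : Pi.HasRank n) {X Y : Pi.Grassmannian k} {S : Set P} {x y : P}
    (hS : Pi.HasDim S ((k : ℤ) - 1)) (hSX : S ⊆ X.1) (hSY : S ⊆ Y.1) (hx : x ∈ X.1) (hxS : x ∉ S)
    (hy : y ∈ Y.1) (hyS : y ∉ S) : (Pi.graph k).Adj X Y ↔ ¬ Pi.Perp x y := by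
  rw [graph_adj_iff]
  constructor
  · rintro ⟨-, h2⟩ hxy
    refine h2 ?_
    rw [← hS.join_eq hr Y.2 hSY hy hyS, ← hS.join_eq hr X.2 hSX hx hxS]
    have hSS := hS.isSingular.subset_perp
    refine join_subset_perp (fun s hs => mem_perp_join.2 ⟨?_, hSS hs⟩)
      (mem_perp_join.2 ⟨hxy.symm, perp_anti hSY (Y.2.isSingular.subset_perp hy)⟩)
    exact X.2.isSingular.perp_of_mem (hSX hs) hx
  · intro hxy
    refine ⟨near_of_subset hS hSX hSY ?_, fun h => hxy (h hy x hx).symm⟩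
    rintro rfl
    exact hxy (X.2.isSingular.perp_of_mem hx hy)

/-- The `k`-dimensional subspace spanned by a hyperplane `S` and a point. -/
theorem exists_grassmannian (hr : Pi.HasRank n) {S : Set P} {x : P}
    (hS : Pi.HasDim S ((k : ℤ) - 1)) (hx : x ∈ Pi.perp S) (hxS : x ∉ S) :
    ∃ X : Pi.Grassmannian k, S ⊆ X.1 ∧ x ∈ X.1 :=
  ⟨⟨Pi.join S x, by simpa using hasDim_join hr hS hx hxS⟩, subset_join S x, mem_join_self S x⟩

/-- Three subspaces pairwise meeting in hyperplanes: the third contains the intersection of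
the other two, unless they are all orthogonal. -/
theorem Near.inter_subset_or (hr : Pi.HasRank n) {X Y Z : Pi.Grassmannian k} (h : Near X Y)
    (hX : Near Z X) (hY : Near Z Y) :
    X.1 ∩ Y.1 ⊆ Z.1 ∨ (Y.1 ⊆ Pi.perp X.1 ∧ Z.1 ⊆ Pi.perp X.1) := by
  by_cases hs : X.1 ∩ Y.1 ⊆ Z.1
  · exact Or.inl hs
  refine Or.inr ?_
  obtain ⟨a, ha, ha'⟩ := HasDim.exists_notMem h hX le_rfl
    fun e => hs (e.subset.trans Set.inter_subset_left)
  obtain ⟨b, hb, hb'⟩ := HasDim.exists_notMem h hY le_rfl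
    fun e => hs (e.subset.trans Set.inter_subset_left)
  have hab : Pi.Perp a b := Z.2.isSingular.perp_of_mem ha.1 hb.1
  have hYX : Y.1 ⊆ Pi.perp X.1 := by
    by_contra hc
    exact (graph_adj_iff_not_perp hr h Set.inter_subset_left Set.inter_subset_right ha.2 ha'
      hb.2 hb').1 (graph_adj_iff.2 ⟨h, hc⟩) hab
  refine ⟨hYX, ?_⟩
  rw [← HasDim.join_eq hr hX Z.2 Set.inter_subset_left hb.1 fun hc => hb' ⟨hc.2, hb.2⟩]
  exact join_subset_perp (Set.inter_subset_right.trans X.2.isSingular.subset_perp) (hYX hb.2)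

theorem Near.inter_subset_of_adj (hr : Pi.HasRank n) {X Y W : Pi.Grassmannian k} (h : Near X Y)
    (hX : (Pi.graph k).Adj X W) (hY : (Pi.graph k).Adj Y W) : X.1 ∩ Y.1 ⊆ W.1 := by
  rcases h.inter_subset_or hr (graph_adj_iff.1 hX).1.symm (graph_adj_iff.1 hY).1.symm with h | h
  · exact h
  · exact absurd h.2 (graph_adj_iff.1 hX).2

theorem inter_subset_of_near (hr : Pi.HasRank n) {X Y Z : Pi.Grassmannian k}
    (h : (Pi.graph k).Adj X Y) (hX : Near Z X) (hY : Near Z Y) : X.1 ∩ Y.1 ⊆ Z.1 := by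
  rcases (graph_adj_iff.1 h).1.inter_subset_or hr hX hY with h' | h'
  · exact h'
  · exact absurd h'.1 (graph_adj_iff.1 h).2

end

/-! ### Recognising subspaces that meet in a hyperplane -/

section
variable {V : Type*}

/-- The vertices `x` and `y` have two common neighbours that are adjacent. -/
def HasEdgeOver (G : SimpleGraph V) (x y : V) : Prop :=
  ∃ w w', G.Adj x w ∧ G.Adj y w ∧ G.Adj x w' ∧ G.Adj y w' ∧ G.Adj w w'

/-- The vertices `x` and `y` have three distinct common neighbours. -/
def HasThreeOver (G : SimpleGraph V) (x y : V) : Prop :=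
  ∃ w₁ w₂ w₃, w₁ ≠ w₂ ∧ w₁ ≠ w₃ ∧ w₂ ≠ w₃ ∧ G.Adj x w₁ ∧ G.Adj y w₁ ∧ G.Adj x w₂ ∧ G.Adj y w₂ ∧
    G.Adj x w₃ ∧ G.Adj y w₃

/-- The graph-theoretic description of the relation `Near` in the graph `Γ'_k`. The last two
alternatives serve the residues that are grids having lines of three points. -/
def Linked (G : SimpleGraph V) (x y : V) : Prop :=
  G.Adj x y ∨ (x ≠ y ∧ ¬ G.Adj x y ∧ (∃ w, G.Adj x w ∧ G.Adj y w) ∧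
    (HasEdgeOver G x y ∨
      (∃ p q, p ≠ q ∧ G.Adj x p ∧ G.Adj y p ∧ G.Adj x q ∧ G.Adj y q ∧ HasEdgeOver G p q) ∨
      ¬ HasThreeOver G x y))

theorem HasEdgeOver.map {G : SimpleGraph V} (f : G ≃g G) {x y : V} (h : HasEdgeOver G x y) :
    HasEdgeOver G (f x) (f y) := by
  obtain ⟨w, w', h1, h2, h3, h4, h5⟩ := h
  exact ⟨f w, f w', f.map_adj_iff.2 h1, f.map_adj_iff.2 h2, f.map_adj_iff.2 h3, f.map_adj_iff.2 h4,
    f.map_adj_iff.2 h5⟩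

theorem HasThreeOver.map {G : SimpleGraph V} (f : G ≃g G) {x y : V} (h : HasThreeOver G x y) :
    HasThreeOver G (f x) (f y) := by
  obtain ⟨w₁, w₂, w₃, h12, h13, h23, h1, h2, h3, h4, h5, h6⟩ := h
  exact ⟨f w₁, f w₂, f w₃, f.injective.ne h12, f.injective.ne h13, f.injective.ne h23,
    f.map_adj_iff.2 h1, f.map_adj_iff.2 h2, f.map_adj_iff.2 h3, f.map_adj_iff.2 h4,
    f.map_adj_iff.2 h5, f.map_adj_iff.2 h6⟩

theorem Linked.map {G : SimpleGraph V} (f : G ≃g G) {x y : V} (h : Linked G x y) :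
    Linked G (f x) (f y) := by
  rcases h with h | ⟨hne, hadj, ⟨w, h1, h2⟩, h⟩
  · exact Or.inl (f.map_adj_iff.2 h)
  refine Or.inr ⟨f.injective.ne hne, fun h' => hadj (f.map_adj_iff.1 h'),
    ⟨f w, f.map_adj_iff.2 h1, f.map_adj_iff.2 h2⟩, ?_⟩
  rcases h with h | ⟨p, q, hpq, h3, h4, h5, h6, h⟩ | h
  · exact Or.inl (h.map f)
  · exact Or.inr (Or.inl ⟨f p, f q, f.injective.ne hpq, f.map_adj_iff.2 h3, f.map_adj_iff.2 h4,
      f.map_adj_iff.2 h5, f.map_adj_iff.2 h6, h.map f⟩)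
  · exact Or.inr (Or.inr fun h' => h (by simpa using h'.map f.symm))

end

section
variable {k n : ℕ}

/-- Common neighbours of two subspaces not meeting in a hyperplane do not meet in
a hyperplane either. -/
theorem not_near_of_not_near (hr : Pi.HasRank n) {X Y W W' : Pi.Grassmannian k} (hne : X ≠ Y)
    (h : ¬ Near X Y) (hXW : (Pi.graph k).Adj X W) (hYW : (Pi.graph k).Adj Y W)
    (hXW' : (Pi.graph k).Adj X W') (hYW' : (Pi.graph k).Adj Y W') : ¬ Near W W' := fun hn =>
  h (near_of_subset hn (hn.inter_subset_of_adj hr hXW.symm hXW'.symm)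
    (hn.inter_subset_of_adj hr hYW.symm hYW'.symm) hne)

/-- Adjacent common neighbours of `X` and `Y` would have their intersection in `X ∩ Y`. -/
theorem not_hasEdgeOver_of_not_near (hr : Pi.HasRank n) {X Y : Pi.Grassmannian k} (hne : X ≠ Y)
    (h : ¬ Near X Y) : ¬ HasEdgeOver (Pi.graph k) X Y := by
  rintro ⟨W, W', h1, h2, h3, h4, h5⟩
  exact not_near_of_not_near hr hne h h1 h2 h3 h4 (graph_adj_iff.1 h5).1

/-- If `X ∩ Y` has codimension two, orthogonal points `c ∈ X` and `d ∈ Y` give a common neighbour,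
namely the subspace spanned by `X ∩ Y`, `c` and `d`, unless `c ⊥ Y` or `d ⊥ X`. -/
theorem exists_common_of_points (hr : Pi.HasRank n) {X Y : Pi.Grassmannian k}
    (hC : Pi.HasDim (X.1 ∩ Y.1) ((k : ℤ) - 1 - 1)) {c d c' d' : P} (hc : c ∈ X.1) (hd : d ∈ Y.1)
    (hc' : c' ∈ X.1) (hd' : d' ∈ Y.1) (hcd : Pi.Perp c d) (hcd' : ¬ Pi.Perp c d')
    (hc'd : ¬ Pi.Perp c' d) :
    ∃ W, (Pi.graph k).Adj X W ∧ (Pi.graph k).Adj Y W ∧ c ∈ W.1 ∧ d ∈ W.1 := by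
  have hcY : c ∉ Y.1 := fun h => hcd' (Y.2.isSingular.perp_of_mem h hd')
  have hdX : d ∉ X.1 := fun h => hc'd (X.2.isSingular.perp_of_mem hc' h)
  have hcC : c ∈ Pi.perp (X.1 ∩ Y.1) :=
    perp_anti Set.inter_subset_left (X.2.isSingular.subset_perp hc)
  have hdC : d ∈ Pi.perp (X.1 ∩ Y.1) :=
    perp_anti Set.inter_subset_right (Y.2.isSingular.subset_perp hd)
  have h1 : Pi.HasDim (Pi.join (X.1 ∩ Y.1) c) ((k : ℤ) - 1) := by
    simpa using hasDim_join hr hC hcC fun h => hcY h.2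
  have h2 : Pi.HasDim (Pi.join (X.1 ∩ Y.1) d) ((k : ℤ) - 1) := by
    simpa using hasDim_join hr hC hdC fun h => hdX h.1
  obtain ⟨W, hW, hdW⟩ := exists_grassmannian hr h1 (mem_perp_join.2 ⟨hcd.symm, hdC⟩)
    fun h => hdX (join_subset X.2.isSingular Set.inter_subset_left hc h)
  have hcW : c ∈ W.1 := hW (mem_join_self _ _)
  refine ⟨W, graph_adj_iff.2 ⟨near_of_subset h1
    (join_subset X.2.isSingular Set.inter_subset_left hc) hW ?_, fun h => ?_⟩,
    graph_adj_iff.2 ⟨near_of_subset h2 (join_subset Y.2.isSingular Set.inter_subset_right hd)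
    (join_subset W.2.isSingular ((subset_join _ _).trans hW) hdW) ?_, fun h => ?_⟩, hcW, hdW⟩
  · rintro rfl
    exact hdX hdW
  · exact hc'd (h hdW c' hc').symm
  · rintro rfl
    exact hcY hcW
  · exact hcd' (h hcW d' hd')

theorem inter_hasDim_of_not_near (hr : Pi.HasRank n) {X Y W : Pi.Grassmannian k} (hne : X ≠ Y)
    (h : ¬ Near X Y) (hX : Near X W) (hY : Near Y W) :
    Pi.HasDim (X.1 ∩ Y.1) ((k : ℤ) - 1 - 1) ∧ X.1 ∩ W.1 ≠ Y.1 ∩ W.1 := by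
  have hAB : X.1 ∩ W.1 ≠ Y.1 ∩ W.1 := fun e =>
    h (near_of_subset hX Set.inter_subset_left (e ▸ Set.inter_subset_left) hne)
  have hC := HasDim.inter hr W.2 hX hY Set.inter_subset_right Set.inter_subset_right hAB
  refine ⟨?_, hAB⟩
  obtain ⟨e, he, -⟩ := exists_hasDim hr (X.2.isSingular.inter Y.2.isSingular)
  have h1 := hC.le he (Set.inter_subset_inter Set.inter_subset_left Set.inter_subset_left)
  have h2 : e < k := by
    refine he.lt X.2 (Set.inter_subset_left.ssubset_of_ne fun e => hne (eq_of_subset ?_))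
    exact Set.inter_eq_left.1 e
  have h3 : e ≠ (k : ℤ) - 1 := by
    rintro rfl
    exact h he
  have h4 : e = (k : ℤ) - 1 - 1 := by omega
  exact h4 ▸ he

/-- In the residue of `X ∩ Y` the subspaces `X` and `Y` are opposite lines, and each of their points
determines a transversal. -/
theorem hasThreeOver_of_not_near (hr : Pi.HasRank n) {X Y W : Pi.Grassmannian k} (hne : X ≠ Y)
    (h : ¬ Near X Y) (hXW : (Pi.graph k).Adj X W) (hYW : (Pi.graph k).Adj Y W) :
    HasThreeOver (Pi.graph k) X Y := by
  have hX := (graph_adj_iff.1 hXW).1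
  have hY := (graph_adj_iff.1 hYW).1
  obtain ⟨hC, hAB⟩ := inter_hasDim_of_not_near hr hne h hX hY
  obtain ⟨b, hb, hb'⟩ := HasDim.exists_notMem hX hY le_rfl hAB
  obtain ⟨a, ha, ha'⟩ := HasDim.exists_notMem hY hX le_rfl hAB.symm
  obtain ⟨a', haX, haW⟩ := hX.exists_left
  obtain ⟨b', hbY, hbW⟩ := hY.exists_left
  have hab : Pi.Perp a b := W.2.isSingular.perp_of_mem ha.2 hb.2
  have ha'b : ¬ Pi.Perp a' b := (graph_adj_iff_not_perp hr hX Set.inter_subset_left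
    Set.inter_subset_right haX (fun h => haW h.2) hb.2 hb').1 hXW
  have hb'a : ¬ Pi.Perp b' a := (graph_adj_iff_not_perp hr hY Set.inter_subset_left
    Set.inter_subset_right hbY (fun h => hbW h.2) ha.2 ha').1 hYW
  have hne_a : a ≠ a' := fun e => ha'b (e ▸ hab)
  have hne_b : b ≠ b' := fun e => hb'a (e ▸ hab.symm)
  obtain ⟨L, hL, haL, ha'L⟩ := exists_line (X.2.isSingular.perp_of_mem ha.1 haX) hne_a
  obtain ⟨M, hM, hbM, hb'M⟩ := exists_line (Y.2.isSingular.perp_of_mem hb.1 hbY) hne_b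
  have hLX : L ⊆ X.1 := X.2.1.1 a ha.1 a' haX hne_a L hL haL ha'L
  have hMY : M ⊆ Y.1 := Y.2.1.1 b hb.1 b' hbY hne_b M hM hbM hb'M
  have hL' : ∀ t ∈ L, t ≠ a → ¬ Pi.Perp t b := fun t ht hta htb =>
    ha'b (perp_of_mem_line hL ht haL ha'L hta htb.symm hab.symm).symm
  have hM' : ∀ t ∈ M, t ≠ b → ¬ Pi.Perp a t := fun t ht htb hta =>
    hb'a (perp_of_mem_line hM ht hbM hb'M htb hta hab).symm
  obtain ⟨b₁, hb₁M, hb₁⟩ := exists_mem_line_perp hM a'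
  have hb₁b : b₁ ≠ b := fun e => ha'b (e ▸ hb₁)
  obtain ⟨a'', ha''L, ha''a, ha''a'⟩ := exists_third_point hL a a'
  obtain ⟨b₂, hb₂M, hb₂⟩ := exists_mem_line_perp hM a''
  have ha''b := hL' a'' ha''L ha''a
  have hb₂b : b₂ ≠ b := fun e => ha''b (e ▸ hb₂)
  obtain ⟨W₁, h1, h1', h1a, h1b⟩ := exists_common_of_points hr hC ha.1 hb.1 haX hbY hab
    (fun h => hb'a h.symm) ha'b
  obtain ⟨W₂, h2, h2', h2a, h2b⟩ := exists_common_of_points hr hC haX (hMY hb₁M) ha.1 hb.1 hb₁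
    ha'b (hM' b₁ hb₁M hb₁b)
  obtain ⟨W₃, h3, h3', h3a, h3b⟩ := exists_common_of_points hr hC (hLX ha''L) (hMY hb₂M) ha.1 hb.1
    hb₂ ha''b (hM' b₂ hb₂M hb₂b)
  refine ⟨W₁, W₂, W₃, ?_, ?_, ?_, h1, h1', h2, h2', h3, h3'⟩
  · rintro rfl
    exact ha'b (W₁.2.isSingular.perp_of_mem h2a h1b)
  · rintro rfl
    exact ha''b (W₁.2.isSingular.perp_of_mem h3a h1b)
  · rintro rfl
    exact hM' b₁ hb₁M hb₁b (perp_of_mem_line hL ha''L ha'L haL ha''a'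
      (W₂.2.isSingular.perp_of_mem h3a h2b).symm hb₁.symm).symm

theorem hasEdgeOver_of_points (hr : Pi.HasRank n) {X Y : Pi.Grassmannian k} {S : Set P}
    {x y w w' : P}
    (hS : Pi.HasDim S ((k : ℤ) - 1)) (hSX : S ⊆ X.1) (hSY : S ⊆ Y.1) (hx : x ∈ X.1) (hxS : x ∉ S)
    (hy : y ∈ Y.1) (hyS : y ∉ S) (hw : w ∈ Pi.perp S) (hw' : w' ∈ Pi.perp S)
    (hwx : ¬ Pi.Perp w x) (hwy : ¬ Pi.Perp w y) (hwx' : ¬ Pi.Perp w' x) (hwy' : ¬ Pi.Perp w' y)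
    (hww' : ¬ Pi.Perp w w') : HasEdgeOver (Pi.graph k) X Y := by
  have hxT : x ∈ Pi.perp S := perp_anti hSX (X.2.isSingular.subset_perp hx)
  have hwS : w ∉ S := fun h => hwx (hxT w h).symm
  have hwS' : w' ∉ S := fun h => hwx' (hxT w' h).symm
  obtain ⟨W, hSW, hwW⟩ := exists_grassmannian hr hS hw hwS
  obtain ⟨W', hSW', hwW'⟩ := exists_grassmannian hr hS hw' hwS'
  exact ⟨W, W', ((graph_adj_iff_not_perp hr hS hSW hSX hwW hwS hx hxS).2 hwx).symm,
    ((graph_adj_iff_not_perp hr hS hSW hSY hwW hwS hy hyS).2 hwy).symm,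
    ((graph_adj_iff_not_perp hr hS hSW' hSX hwW' hwS' hx hxS).2 hwx').symm,
    ((graph_adj_iff_not_perp hr hS hSW' hSY hwW' hwS' hy hyS).2 hwy').symm,
    (graph_adj_iff_not_perp hr hS hSW hSW' hwW hwS hwW' hwS').2 hww'⟩

theorem disjoint_line {X : Pi.Grassmannian k} {S L : Set P} {x y : P}
    (hX : S ⊆ X.1) (hL : L ∈ Pi.lines) (hxL : x ∈ L) (hyL : y ∈ L)
    (hx : x ∈ X.1) (hxS : x ∉ S) (hyX : y ∉ X.1) : ∀ s ∈ L, s ∉ S := fun s hsL hs =>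
  hyX (X.2.1.1 x hx s (hX hs) (fun e => hxS (e ▸ hs)) L hL hxL hsL hyL)

/-- Let `X` and `Y` be orthogonal, spanned by `S = X ∩ Y` and points `x`, `y`. If the line `xy` has
exactly one further point `z` and there are three common neighbours but no two adjacent ones, then
the common neighbours lie on a line of the residue of `S` with `z`. That line has at least
four points, so `exists_pair_of_four_points` applies to two of the common neighbours. -/
theorem Near.linked (hr : Pi.HasRank n) {X Y : Pi.Grassmannian k}
    (h : Near X Y) : Linked (Pi.graph k) X Y := by
  by_cases hadj : (Pi.graph k).Adj X Y
  · exact Or.inl hadj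
  refine Or.inr ⟨h.ne, hadj, ?_⟩
  obtain ⟨S, hS_def⟩ : ∃ S, S = X.1 ∩ Y.1 := ⟨_, rfl⟩
  have hS : Pi.HasDim S ((k : ℤ) - 1) := hS_def ▸ h
  have hSX : S ⊆ X.1 := hS_def ▸ Set.inter_subset_left
  have hSY : S ⊆ Y.1 := hS_def ▸ Set.inter_subset_right
  obtain ⟨x, hx, hxY⟩ := h.exists_left
  obtain ⟨y, hy, hyX⟩ := h.symm.exists_left
  have hxS : x ∉ S := fun h => hxY (hSY h)
  have hyS : y ∉ S := fun h => hyX (hSX h)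
  have hxy : Pi.Perp x y := by
    by_contra hc
    exact hadj ((graph_adj_iff_not_perp hr hS hSX hSY hx hxS hy hyS).2 hc)
  have hxT : x ∈ Pi.perp S := perp_anti hSX (X.2.isSingular.subset_perp hx)
  have hyT : y ∈ Pi.perp S := perp_anti hSY (Y.2.isSingular.subset_perp hy)
  have hne : x ≠ y := fun e => hxY (e ▸ hy)
  obtain ⟨L, hL, hxL, hyL⟩ := exists_line hxy hne
  have hLT : L ⊆ Pi.perp S := Pi.isSubspace_perp S x hxT y hyT hne L hL hxL hyL
  have hLS : ∀ s ∈ L, s ∉ S := disjoint_line hSX hL hxL hyL hx hxS hyX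
  obtain ⟨z, hzL, hzx, hzy⟩ := exists_third_point hL x y
  constructor
  · obtain ⟨p, hp, -, hpL⟩ := exists_perp_only hS.isSingular hL hLT hLS hxL hzL hzx.symm
    have hpx := hpL x hxL hzx.symm
    have hpS : p ∉ S := fun h => hpx (hxT p h).symm
    obtain ⟨W, hSW, hpW⟩ := exists_grassmannian hr hS hp hpS
    exact ⟨W, ((graph_adj_iff_not_perp hr hS hSW hSX hpW hpS hx hxS).2 hpx).symm,
      ((graph_adj_iff_not_perp hr hS hSW hSY hpW hpS hy hyS).2 (hpL y hyL hzy.symm)).symm⟩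
  by_contra! hcon
  obtain ⟨hE, hE', W₁, W₂, W₃, h12, h13, h23, hX1, hY1, hX2, hY2, hX3, hY3⟩ := hcon
  have hL3 : ∀ t ∈ L, t ≠ x → t ≠ y → t = z := by
    intro t ht htx hty
    by_contra htz
    obtain ⟨w, hw, w', hw', h1, h2, h3, h4, h5⟩ := exists_pair_of_four_points hS.isSingular hL hLT
      hLS hxL hyL hzL ht hzx.symm hzy.symm (Ne.symm htx) (Ne.symm hty) (Ne.symm htz)
    exact hE (hasEdgeOver_of_points hr hS hSX hSY hx hxS hy hyS hw hw' h1 h2 h3 h4 h5)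
  have hcommon : ∀ W : Pi.Grassmannian k, (Pi.graph k).Adj X W → (Pi.graph k).Adj Y W →
      S ⊆ W.1 ∧ (∀ w ∈ W.1, w ∉ S → ¬ Pi.Perp w x ∧ ¬ Pi.Perp w y ∧ Pi.Perp w z) ∧
        ∃ w ∈ W.1, w ∉ S := by
    intro W hXW hYW
    have hSW : S ⊆ W.1 := hS_def ▸ h.inter_subset_of_adj hr hXW hYW
    refine ⟨hSW, fun w hw hwS => ?_, hS.exists_notMem W.2 (by omega) fun e => ?_⟩
    · have h1 := (graph_adj_iff_not_perp hr hS hSW hSX hw hwS hx hxS).1 hXW.symm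
      have h2 := (graph_adj_iff_not_perp hr hS hSW hSY hw hwS hy hyS).1 hYW.symm
      obtain ⟨t, htL, hwt⟩ := exists_mem_line_perp hL w
      refine ⟨h1, h2, ?_⟩
      rw [← hL3 t htL (fun e => h1 (e ▸ hwt)) (fun e => h2 (e ▸ hwt))]
      exact hwt
    · have := (e ▸ hS).unique W.2
      omega
  obtain ⟨hS1, hc1, w₁, hw1, hw1S⟩ := hcommon W₁ hX1 hY1
  obtain ⟨hS2, hc2, w₂, hw2, hw2S⟩ := hcommon W₂ hX2 hY2
  obtain ⟨hS3, hc3, w₃, hw3, hw3S⟩ := hcommon W₃ hX3 hY3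
  have hT : ∀ W : Pi.Grassmannian k, S ⊆ W.1 → ∀ w ∈ W.1, w ∈ Pi.perp S := fun W hW w hw =>
    perp_anti hW (W.2.isSingular.subset_perp hw)
  have hZs : Pi.IsSingular (Pi.join S z) := isSingular_join hS.isSingular (hLT hzL)
  have hxZ : x ∈ Pi.perp (Pi.join S z) := mem_perp_join.2 ⟨mem_line_perp hL hxL hzL, hxT⟩
  -- Any further common neighbour lies in the plane of the residue spanned by `z` and `w₁`.
  have hplane : ∀ W : Pi.Grassmannian k, (Pi.graph k).Adj X W → (Pi.graph k).Adj Y W → W₁ ≠ W →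
      W.1 ⊆ Pi.join (Pi.join S z) w₁ := by
    intro W hXW hYW hne1
    obtain ⟨hSW, hc, w, hw, hwS⟩ := hcommon W hXW hYW
    rw [← hS.join_eq hr W.2 hSW hw hwS]
    refine join_subset
      (isSingular_join hZs (mem_perp_join.2 ⟨(hc1 w₁ hw1 hw1S).2.2, hT _ hS1 _ hw1⟩))
      ((subset_join S z).trans (subset_join _ _)) ?_
    by_contra hwE
    have hw1w : Pi.Perp w₁ w := by
      by_contra hc'
      exact hE ⟨W₁, W, hX1, hY1, hXW, hYW,
        (graph_adj_iff_not_perp hr hS hS1 hSW hw1 hw1S hw hwS).2 hc'⟩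
    obtain ⟨v, hv, hvx, hvw⟩ := exists_not_perp_not_perp hZs hxZ
      (mem_perp_join.2 ⟨(hc1 w₁ hw1 hw1S).2.2, hT _ hS1 _ hw1⟩)
      (mem_perp_join.2 ⟨(hc w hw hwS).2.2, hT _ hSW _ hw⟩)
      (fun h => (hc1 w₁ hw1 hw1S).1 h.symm) hw1w hwE
    obtain ⟨hvz, hvS⟩ := mem_perp_join.1 hv
    exact hE (hasEdgeOver_of_points hr hS hSX hSY hx hxS hy hyS hvS (hT _ hS1 _ hw1) hvx
      (fun h => hvx (perp_of_mem_line hL hyL hzL hxL hzy.symm h hvz))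
      (hc1 w₁ hw1 hw1S).1 (hc1 w₁ hw1 hw1S).2.1 hvw)
  have hw1T := hT _ hS1 _ hw1
  have hw2T := hT _ hS2 _ hw2
  have hw1Z : w₁ ∈ Pi.perp (Pi.join S z) := mem_perp_join.2 ⟨(hc1 w₁ hw1 hw1S).2.2, hw1T⟩
  have hout : ∀ W : Pi.Grassmannian k, S ⊆ W.1 → W₁ ≠ W → ∀ w ∈ W.1, w ∉ S → w ∉ W₁.1 := by
    intro W hSW hne1 w hw hwS hw'
    have e := inter_eq_of_subset hS hS1 hSW hne1
    exact hwS (e ▸ ⟨hw', hw⟩)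
  have hw2W1 : w₂ ∉ W₁.1 := hout W₂ hS2 h12 w₂ hw2 hw2S
  have hw12 : w₁ ≠ w₂ := fun e => hw2W1 (e ▸ hw1)
  obtain ⟨M, hM, hw1M, hw2M, z₁, hz1M, hz1⟩ := mem_join hZs hw1Z (hplane W₂ hX2 hY2 h12 hw2) hw12
  have hMS : ∀ s ∈ M, s ∉ S :=
    disjoint_line hS1 hM hw1M hw2M hw1 hw1S hw2W1
  have hMT : M ⊆ Pi.perp S := Pi.isSubspace_perp S w₁ hw1T w₂ hw2T hw12 M hM hw1M hw2M
  have hw1W3 : w₁ ∉ W₃.1 := fun h' => hout W₃ hS3 h13 w₁ h' hw1S hw1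
  -- The line `M` through `w₁` and `w₂` meets `W₃` in a point.
  have hzS : z ∉ S := hLS z hzL
  have hZd : Pi.HasDim (Pi.join S z) k := by simpa using hasDim_join hr hS (hLT hzL) hzS
  have hz1x : Pi.Perp z₁ x := (hxZ z₁ hz1).symm
  have hw1nZ : w₁ ∉ Pi.join S z := fun h' => (hc1 w₁ hw1 hw1S).1 (hxZ w₁ h').symm
  have hEd := hasDim_join hr hZd hw1Z hw1nZ
  have hW3d : Pi.HasDim W₃.1 ((k : ℤ) + 1 - 1) := by simpa using W₃.2
  have hW3E := hplane W₃ hX3 hY3 h13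
  have hEeq := hW3d.join_eq hr hEd hW3E (mem_join_self _ _) hw1W3
  have hw1W3' : w₁ ∈ Pi.perp W₃.1 :=
    perp_anti hW3E (hEd.isSingular.subset_perp (mem_join_self _ _))
  obtain ⟨M', hM', hw1M', hw2M', v, hvM', hv⟩ := mem_join W₃.2.isSingular hw1W3'
    (hEeq ▸ hplane W₂ hX2 hY2 h12 hw2) hw12
  obtain rfl := Pi.line_unique w₁ w₂ hw12 M hM M' hM' hw1M hw2M hw1M' hw2M'
  have hvS := hMS v hvM'
  have hvx := (hc3 v hv hvS).1
  have hw2v : w₂ ≠ v := by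
    rintro rfl
    have e := inter_eq_of_subset hS hS2 hS3 h23
    exact hw2S (e ▸ ⟨hw2, hv⟩)
  obtain ⟨u, hu, u', hu', h1, h2, h3, h4, h5⟩ := exists_pair_of_four_points hS.isSingular hM hMT
    hMS hw1M hw2M hz1M hvM' (fun e => (hc1 w₁ hw1 hw1S).1 (e ▸ hz1x))
    (fun e => (hc2 w₂ hw2 hw2S).1 (e ▸ hz1x)) (fun e => hw1W3 (e ▸ hv)) hw2v
    (fun e => hvx (e ▸ hz1x))
  exact hE' W₁ W₂ h12 hX1 hY1 hX2 hY2
    (hasEdgeOver_of_points hr hS hS1 hS2 hw1 hw1S hw2 hw2S hu hu' h1 h2 h3 h4 h5)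

theorem near_iff_linked (hr : Pi.HasRank n) {X Y : Pi.Grassmannian k} :
    Near X Y ↔ Linked (Pi.graph k) X Y := by
  refine ⟨fun h => h.linked hr, ?_⟩
  rintro (h | ⟨hne, -, ⟨W, hXW, hYW⟩, h⟩)
  · exact (graph_adj_iff.1 h).1
  by_contra hn
  rcases h with h | ⟨p, q, hpq, h1, h2, h3, h4, h⟩ | h
  · exact not_hasEdgeOver_of_not_near hr hne hn h
  · exact not_hasEdgeOver_of_not_near hr hpq (not_near_of_not_near hr hne hn h1 h2 h3 h4) h
  · exact h (hasThreeOver_of_not_near hr hne hn hXW hYW)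

end

/-! ### The induced bijection on hyperplanes -/

section
variable {j n : ℕ}

theorem near_map_iff {k : ℕ} (hr : Pi.HasRank n) (f : Pi.graph k ≃g Pi.graph k)
    {X Y : Pi.Grassmannian k} : Near (f X) (f Y) ↔ Near X Y := by
  simp only [near_iff_linked hr]
  exact ⟨fun h => by simpa using h.map f.symm, fun h => h.map f⟩

/-- The subspaces through the intersection of two adjacent subspaces. -/
theorem inter_subset_iff {k : ℕ} (hr : Pi.HasRank n) {X Y Z : Pi.Grassmannian k}
    (h : (Pi.graph k).Adj X Y) :
    X.1 ∩ Y.1 ⊆ Z.1 ↔ (Z = X ∨ Near Z X) ∧ (Z = Y ∨ Near Z Y) := by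
  have hn := (graph_adj_iff.1 h).1
  constructor
  · intro hs
    exact ⟨or_iff_not_imp_left.2 (near_of_subset hn hs Set.inter_subset_left),
      or_iff_not_imp_left.2 (near_of_subset hn hs Set.inter_subset_right)⟩
  · rintro ⟨rfl | h1, h2⟩
    · exact Set.inter_subset_left
    · rcases h2 with rfl | h2
      · exact Set.inter_subset_right
      · exact inter_subset_of_near hr h h1 h2

theorem hasDim_pred (S : Pi.Grassmannian j) : Pi.HasDim S.1 (((j + 1 : ℕ) : ℤ) - 1) := by
  simpa using S.2

theorem exists_adj_inter_eq (hr : Pi.HasRank n) (hj : j + 2 ≤ n) (S : Pi.Grassmannian j) :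
    ∃ X Y : Pi.Grassmannian (j + 1), (Pi.graph (j + 1)).Adj X Y ∧ X.1 ∩ Y.1 = S.1 := by
  obtain ⟨x, hx, hxS⟩ := S.2.exists_mem_perp hr (by omega)
  obtain ⟨y, hy, hxy⟩ : ∃ y ∈ Pi.perp S.1, ¬ Pi.Perp x y := by
    by_contra! h
    exact hxS (S.2.isSingular.perp_perp ▸ h)
  have hyS : y ∉ S.1 := fun h => hxy (hx y h)
  obtain ⟨X, hSX, hxX⟩ := exists_grassmannian hr (hasDim_pred S) hx hxS
  obtain ⟨Y, hSY, hyY⟩ := exists_grassmannian hr (hasDim_pred S) hy hyS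
  have h := (graph_adj_iff_not_perp hr (hasDim_pred S) hSX hSY hxX hxS hyY hyS).2 hxy
  exact ⟨X, Y, h, inter_eq_of_subset (hasDim_pred S) hSX hSY h.ne⟩

/-- The image of `S` is `f X ∩ f Y` for any adjacent `X`, `Y` with `X ∩ Y = S`. -/
theorem exists_image_hyperplane (hr : Pi.HasRank n) (hj : j + 2 ≤ n)
    (f : Pi.graph (j + 1) ≃g Pi.graph (j + 1)) (S : Pi.Grassmannian j) :
    ∃ S' : Pi.Grassmannian j, ∀ Z, S'.1 ⊆ (f Z).1 ↔ S.1 ⊆ Z.1 := by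
  obtain ⟨X, Y, h, hS⟩ := exists_adj_inter_eq hr hj S
  have h' : (Pi.graph (j + 1)).Adj (f X) (f Y) := f.map_adj_iff.2 h
  refine ⟨⟨(f X).1 ∩ (f Y).1, by simpa [Near] using (graph_adj_iff.1 h').1⟩, fun Z => ?_⟩
  rw [← hS, inter_subset_iff hr h, inter_subset_iff hr h', near_map_iff hr, near_map_iff hr,
    f.injective.eq_iff, f.injective.eq_iff]

theorem eq_of_forall_subset_iff (hr : Pi.HasRank n) (hj : j + 2 ≤ n) {S T : Pi.Grassmannian j}
    (h : ∀ Z : Pi.Grassmannian (j + 1), S.1 ⊆ Z.1 → T.1 ⊆ Z.1) : S = T := by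
  obtain ⟨X, Y, -, hS⟩ := exists_adj_inter_eq hr hj S
  refine (eq_of_subset ?_).symm
  rw [← hS]
  exact Set.subset_inter (h X (hS ▸ Set.inter_subset_left)) (h Y (hS ▸ Set.inter_subset_right))

/-- An automorphism of `Γ'_{j+1}` acts on the `j`-dimensional subspaces compatibly with
inclusion. -/
theorem exists_equiv_hyperplane (hr : Pi.HasRank n) (hj : j + 2 ≤ n)
    (f : Pi.graph (j + 1) ≃g Pi.graph (j + 1)) :
    ∃ g : Pi.Grassmannian j ≃ Pi.Grassmannian j, ∀ S Z, (g S).1 ⊆ (f Z).1 ↔ S.1 ⊆ Z.1 := by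
  choose g hg using exists_image_hyperplane hr hj f
  choose g' hg' using exists_image_hyperplane hr hj f.symm
  refine ⟨⟨g, g', fun S => ?_, fun S => ?_⟩, hg⟩
  · refine eq_of_forall_subset_iff hr hj fun Z hZ => ?_
    have h1 := hg' (g S) (f Z)
    rw [f.symm_apply_apply] at h1
    rwa [h1, hg S] at hZ
  · refine eq_of_forall_subset_iff hr hj fun Z hZ => ?_
    have h1 := hg (g' S) (f.symm Z)
    rw [f.apply_symm_apply] at h1
    rwa [h1, hg' S] at hZ

/-! ### Adjacency in terms of incidence -/

section
variable {A B : Type*}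

/-- The objects `s` and `t` are incident with a common object. -/
def Joined (I : A → B → Prop) (s t : A) : Prop :=
  ∃ x, I s x ∧ I t x

/-- The description of weak adjacency of `j`-dimensional subspaces in terms of
their incidence with the `(j+1)`-dimensional subspaces. -/
def WeaklyJoined (I : A → B → Prop) (s t : A) : Prop :=
  ¬ Joined I s t ∧
    (∃ r r', r ≠ r' ∧ Joined I r s ∧ Joined I r t ∧ Joined I r' s ∧ Joined I r' t) ∧
    ∀ x r r', I t x → r ≠ r' → Joined I r s → Joined I r' s → I r x → ¬ I r' x

theorem weaklyJoined_map_iff {I : A → B → Prop} (g : A ≃ A) (f : B ≃ B)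
    (h : ∀ s x, I (g s) (f x) ↔ I s x) (s t : A) :
    WeaklyJoined I (g s) (g t) ↔ WeaklyJoined I s t := by
  have hJ : ∀ s t, Joined I (g s) (g t) ↔ Joined I s t := fun s t => by
    rw [Joined, f.surjective.exists]
    simp only [h]
    rfl
  rw [WeaklyJoined, g.surjective.exists₂, f.surjective.forall]
  have h3 : (∀ x r r', I (g t) (f x) → r ≠ r' → Joined I r (g s) → Joined I r' (g s) →
      I r (f x) → ¬ I r' (f x)) ↔
      ∀ x r r', I t x → r ≠ r' → Joined I r s → Joined I r' s → I r x → ¬ I r' x := by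
    refine forall_congr' fun x => ?_
    rw [g.surjective.forall₂]
    simp only [h, hJ, ne_eq, g.injective.eq_iff]
  rw [h3]
  simp only [hJ, ne_eq, g.injective.eq_iff]
  rfl

end

/-- Inclusion of `j`-dimensional in `(j+1)`-dimensional singular subspaces. -/
def Inc (S : Pi.Grassmannian j) (X : Pi.Grassmannian (j + 1)) : Prop :=
  S.1 ⊆ X.1

theorem Joined.near (hr : Pi.HasRank n) {S T : Pi.Grassmannian j} (h : Joined Inc S T)
    (hne : S ≠ T) : Near S T := by
  obtain ⟨X, hS, hT⟩ := h
  have := HasDim.inter hr X.2 (hasDim_pred S) (hasDim_pred T) hS hT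
    (fun e => hne (Subtype.ext e))
  simpa [Near] using this

theorem Joined.subset_perp {S T : Pi.Grassmannian j} (h : Joined Inc S T) :
    S.1 ⊆ Pi.perp T.1 := by
  obtain ⟨X, hS, hT⟩ := h
  exact hS.trans (X.2.isSingular.subset_perp.trans (perp_anti hT))

theorem joined_of_subset_perp (hr : Pi.HasRank n) {S T : Pi.Grassmannian j} (h : Near S T)
    (hp : T.1 ⊆ Pi.perp S.1) : Joined Inc S T := by
  obtain ⟨t, ht, htS⟩ := h.symm.exists_left
  obtain ⟨X, hSX, htX⟩ := exists_grassmannian hr (hasDim_pred S) (hp ht) htS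
  refine ⟨X, hSX, ?_⟩
  rw [Inc, ← HasDim.join_eq hr h T.2 Set.inter_subset_right ht fun h' => htS h'.1]
  exact join_subset X.2.isSingular (Set.inter_subset_left.trans hSX) htX

/-- A singular subspace `E` below the top dimension can be enlarged by a point orthogonal to a given
point `b`, provided that `b` is not orthogonal to `E`. -/
theorem exists_mem_perp_notMem (hr : Pi.HasRank n) {E : Set P} {d : ℤ} (hE : Pi.HasDim E d)
    (hd : d + 2 ≤ n) {a b : P} (ha : a ∈ E) (hab : ¬ Pi.Perp a b) :
    ∃ t ∈ Pi.perp E, t ∉ E ∧ Pi.Perp t b := by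
  obtain ⟨c, hc, hcE⟩ := hE.exists_mem_perp hr hd
  have hne : c ≠ a := fun e => hcE (e ▸ ha)
  obtain ⟨L, hL, hcL, haL⟩ := exists_line (hc a ha) hne
  obtain ⟨t, htL, hbt⟩ := exists_mem_line_perp hL b
  have hta : t ≠ a := fun e => hab (e ▸ hbt).symm
  exact ⟨t, Pi.isSubspace_perp E c hc a (hE.isSingular.subset_perp ha) hne L hL hcL haL htL,
    fun htE => hcE (hE.isSingular.1 t htE a ha hta L hL htL haL hcL), hbt.symm⟩

/-- If `S` and `T` are adjacent, they are non-orthogonal points of the residue of `S ∩ T`, and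
points orthogonal to both are common neighbours. Two subspaces `R`, `R'` as in the last clause would
span a subspace containing `T` and orthogonal to `S`. -/
theorem weaklyJoined_of_adj (hr : Pi.HasRank n) (hj : j + 3 ≤ n) {S T : Pi.Grassmannian j}
    (h : (Pi.graph j).Adj S T) : WeaklyJoined Inc S T := by
  obtain ⟨hn, hp⟩ := graph_adj_iff.1 h
  obtain ⟨a, ha, haT⟩ := hn.exists_left
  obtain ⟨b, hb, hbS⟩ := hn.symm.exists_left
  have hab : ¬ Pi.Perp a b := (graph_adj_iff_not_perp hr hn Set.inter_subset_left
    Set.inter_subset_right ha (fun h => haT h.2) hb fun h => hbS h.1).1 h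
  refine ⟨fun h' => hp (subset_perp_symm h'.subset_perp), ?_, ?_⟩
  · have hpt : ∀ t ∈ Pi.perp S.1, t ∉ S.1 → Pi.Perp t b → ∃ R : Pi.Grassmannian j,
        t ∈ R.1 ∧ R.1 ⊆ Pi.join S.1 t ∧ Joined Inc R S ∧ Joined Inc R T := by
      intro t ht htS htb
      have htT : t ∉ T.1 := fun htT => (graph_adj_iff_not_perp hr hn Set.inter_subset_left
        Set.inter_subset_right ha (fun h => haT h.2) htT fun h => htS h.1).1 h (ht a ha).symm
      have htD : t ∉ S.1 ∩ T.1 := fun h => htS h.1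
      have htD' : t ∈ Pi.perp (S.1 ∩ T.1) := perp_anti Set.inter_subset_left ht
      obtain ⟨R, hDR, htR⟩ := exists_grassmannian hr hn htD' htD
      have hR : Pi.join (S.1 ∩ T.1) t = R.1 := HasDim.join_eq hr hn R.2 hDR htR htD
      have htT' : t ∈ Pi.perp T.1 := by
        rw [← HasDim.join_eq hr hn T.2 Set.inter_subset_right hb fun h => hbS h.1, mem_perp_join]
        exact ⟨htb, htD'⟩
      refine ⟨R, htR, ?_, ?_, ?_⟩
      · rw [← hR]
        exact join_subset (isSingular_join S.2.isSingular ht)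
          (Set.inter_subset_left.trans (subset_join _ _)) (mem_join_self _ _)
      · obtain ⟨X, hX, htX⟩ := exists_grassmannian hr (hasDim_pred S) ht htS
        exact ⟨X, hR.symm.subset.trans
          (join_subset X.2.isSingular (Set.inter_subset_left.trans hX) htX), hX⟩
      · obtain ⟨X, hX, htX⟩ := exists_grassmannian hr (hasDim_pred T) htT' htT
        exact ⟨X, hR.symm.subset.trans
          (join_subset X.2.isSingular (Set.inter_subset_right.trans hX) htX), hX⟩
    obtain ⟨t, ht, htS, htb⟩ := exists_mem_perp_notMem hr S.2 (by omega) ha hab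
    obtain ⟨t', ht', htS', htb'⟩ := exists_mem_perp_notMem hr (hasDim_join hr S.2 ht htS)
      (by omega) (subset_join _ _ ha) hab
    obtain ⟨R, htR, hR, h1, h2⟩ := hpt t ht htS htb
    obtain ⟨R', htR', -, h1', h2'⟩ := hpt t' (perp_anti (subset_join _ _) ht')
      (fun h => htS' (subset_join _ _ h)) htb'
    refine ⟨R, R', ?_, h1, h2, h1', h2'⟩
    rintro rfl
    exact htS' (hR htR')
  · intro X R R' hTX hne hRS hRS' hRX hRX'
    obtain ⟨r, hr', hrR⟩ := R.2.exists_notMem R'.2 le_rfl fun e => hne (Subtype.ext e)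
    refine hp (hTX.trans ?_)
    rw [← (hasDim_pred R).join_eq hr X.2 hRX (hRX' hr') hrR]
    exact join_subset_perp hRS.subset_perp (hRS'.subset_perp hr')

theorem subset_perp_of_two_joined (hr : Pi.HasRank n) {S T R R' : Pi.Grassmannian j}
    (hRS : Near S R) (hRS' : Near S R') (hRT : Joined Inc R T) (hRT' : Joined Inc R' T)
    (hne : S.1 ∩ R.1 ≠ S.1 ∩ R'.1) : S.1 ⊆ Pi.perp T.1 := by
  obtain ⟨s, hs, hs'⟩ := HasDim.exists_notMem hRS hRS' le_rfl hne
  rw [← HasDim.join_eq hr hRS S.2 Set.inter_subset_left hs.1 hs']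
  exact join_subset_perp (Set.inter_subset_right.trans hRT.subset_perp) (hRT'.subset_perp hs.2)

/-- If `S` and `T` were not adjacent, two common neighbours `R`, `R'` in the incidence geometry
could only exist when `S ⊥ T` and `S ∩ T` has codimension two. Then the last clause of
`WeaklyJoined` fails, as two transversals through a point `a ∈ S` lie in the join of `T` and `a`. -/
theorem adj_of_weaklyJoined (hr : Pi.HasRank n) {S T : Pi.Grassmannian j}
    (h : WeaklyJoined Inc S T) : (Pi.graph j).Adj S T := by
  obtain ⟨hST, ⟨R, R', hne, hRS, hRT, hRS', hRT'⟩, hno⟩ := h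
  have hneST : S ≠ T := by
    rintro rfl
    obtain ⟨X, -, hX⟩ := hRS
    exact hST ⟨X, hX, hX⟩
  by_cases hn : Near S T
  · exact graph_adj_iff.2 ⟨hn, fun hp => hST (joined_of_subset_perp hr hn hp)⟩
  have hnear : ∀ R : Pi.Grassmannian j, Joined Inc R S → Joined Inc R T → Near S R ∧ Near T R := by
    intro R h1 h2
    refine ⟨(h1.near hr ?_).symm, (h2.near hr ?_).symm⟩
    · rintro rfl
      exact hST h2
    · rintro rfl
      obtain ⟨X, h3, h4⟩ := h1
      exact hST ⟨X, h4, h3⟩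
  obtain ⟨hSR, hTR⟩ := hnear R hRS hRT
  obtain ⟨hSR', hTR'⟩ := hnear R' hRS' hRT'
  obtain ⟨hD, hAB⟩ := inter_hasDim_of_not_near hr hneST hn hSR hTR
  have hperp : S.1 ⊆ Pi.perp T.1 := by
    by_cases h1 : S.1 ∩ R.1 = S.1 ∩ R'.1
    · by_cases h2 : T.1 ∩ R.1 = T.1 ∩ R'.1
      · obtain ⟨b, hb, hb'⟩ := HasDim.exists_notMem hSR hTR le_rfl hAB
        refine absurd (eq_of_subset ?_) hne
        rw [← HasDim.join_eq hr hSR R.2 Set.inter_subset_right hb.2 hb']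
        exact join_subset R'.2.isSingular (h1 ▸ Set.inter_subset_right) (h2.subset hb).2
      · exact subset_perp_symm (subset_perp_of_two_joined hr hTR hTR' hRS hRS' h2)
    · exact subset_perp_of_two_joined hr hSR hSR' hRT hRT' h1
  obtain ⟨a, ha, haT⟩ : ∃ a ∈ S.1, a ∉ T.1 := by
    by_contra! hs
    exact hneST (eq_of_subset hs)
  obtain ⟨b, hb, hbS⟩ : ∃ b ∈ T.1, b ∉ S.1 := by
    by_contra! hs
    exact hneST (eq_of_subset hs).symm
  have hDS := S.2.isSingular.subset_perp.trans (perp_anti (Set.inter_subset_left (t := T.1)))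
  have hDT := T.2.isSingular.subset_perp.trans (perp_anti (Set.inter_subset_right (s := S.1)))
  have hDb : Pi.HasDim (Pi.join (S.1 ∩ T.1) b) ((j : ℤ) - 1) := by
    simpa using hasDim_join hr hD (hDT hb) fun h => hbS h.1
  have hDa : Pi.HasDim (Pi.join (S.1 ∩ T.1) a) ((j : ℤ) - 1) := by
    simpa using hasDim_join hr hD (hDS ha) fun h => haT h.2
  have hDbT : Pi.join (S.1 ∩ T.1) b ⊆ T.1 :=
    join_subset T.2.isSingular Set.inter_subset_right hb
  have hDaS : Pi.join (S.1 ∩ T.1) a ⊆ S.1 :=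
    join_subset S.2.isSingular Set.inter_subset_left ha
  obtain ⟨b', hb', hbb'⟩ := hDb.exists_notMem T.2 (by omega) fun e => by
    have := (e ▸ hDb).unique T.2
    omega
  have hb'S : b' ∉ S.1 := fun h => hbb' (subset_join _ _ ⟨h, hb'⟩)
  have hperp' : T.1 ⊆ Pi.perp S.1 := subset_perp_symm hperp
  have htr : ∀ c ∈ T.1, c ∉ S.1 → ∃ Q : Pi.Grassmannian j, c ∈ Q.1 ∧
      Pi.join (S.1 ∩ T.1) a ⊆ Q.1 ∧ Joined Inc Q S ∧
      ∀ X : Pi.Grassmannian (j + 1), T.1 ⊆ X.1 → a ∈ X.1 → Q.1 ⊆ X.1 := by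
    intro c hc hcS
    have hcE : c ∉ Pi.join (S.1 ∩ T.1) a := fun h => hcS (hDaS h)
    obtain ⟨Q, hQ, hcQ⟩ := exists_grassmannian hr hDa (perp_anti hDaS (hperp' hc)) hcE
    have hQe := hDa.join_eq hr Q.2 hQ hcQ hcE
    refine ⟨Q, hcQ, hQ, ?_, fun X hTX haX => ?_⟩
    · obtain ⟨X, hSX, hcX⟩ := exists_grassmannian hr (hasDim_pred S) (hperp' hc) hcS
      exact ⟨X, hQe.symm.subset.trans (join_subset X.2.isSingular (hDaS.trans hSX) hcX), hSX⟩
    · exact hQe.symm.subset.trans (join_subset X.2.isSingular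
        (join_subset X.2.isSingular (Set.inter_subset_right.trans hTX) haX) (hTX hc))
  obtain ⟨Q, hbQ, hEQ, hQS, hQ⟩ := htr b hb hbS
  obtain ⟨Q', hbQ', -, hQS', hQ'⟩ := htr b' hb' hb'S
  obtain ⟨X, hTX, haX⟩ := exists_grassmannian hr (hasDim_pred T) (hperp ha) haT
  refine absurd (hQ' X hTX haX) (hno X Q Q' hTX ?_ hQS hQS' (hQ X hTX haX))
  rintro rfl
  have hTQ : T.1 ⊆ Q.1 := by
    rw [← hDb.join_eq hr T.2 hDbT hb' hbb']
    exact join_subset Q.2.isSingular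
      (join_subset Q.2.isSingular ((subset_join _ _).trans hEQ) hbQ) hbQ'
  have e := eq_of_subset hTQ
  exact haT (e ▸ hEQ (mem_join_self _ _))

/-- In rank at least `j + 3`, weak adjacency of `j`-dimensional subspaces can be recognised from
the incidence with `(j+1)`-dimensional ones. -/
theorem graph_adj_iff_weaklyJoined (hr : Pi.HasRank n) (hj : j + 3 ≤ n)
    {S T : Pi.Grassmannian j} : (Pi.graph j).Adj S T ↔ WeaklyJoined Inc S T :=
  ⟨weaklyJoined_of_adj hr hj, adj_of_weaklyJoined hr⟩

end

/-! ### Points and lines -/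

section
variable {n : ℕ}

theorem join_empty (p : P) : Pi.join ∅ p = {p} := by
  have h0 : Pi.IsSingular (∅ : Set P) := ⟨by simp [IsSubspace], by simp⟩
  refine Set.Subset.antisymm (fun c hc => ?_) (Set.singleton_subset_iff.2 (mem_join_self _ _))
  by_contra hne
  obtain ⟨_, _, _, _, s, _, hs⟩ := mem_join h0 (p := p) (fun _ h => h.elim) hc (Ne.symm hne)
  exact hs

theorem hasDim_singleton (hr : Pi.HasRank n) (p : P) : Pi.HasDim {p} 0 := by
  rw [← join_empty]
  exact hasDim_join hr (hasDim_empty hr) (fun _ h => h.elim) (Set.notMem_empty p)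

/-- The points are the `0`-dimensional singular subspaces. -/
noncomputable def pointEquiv (hr : Pi.HasRank n) : P ≃ Pi.Grassmannian 0 :=
  Equiv.ofBijective (fun p => ⟨{p}, hasDim_singleton hr p⟩)
    ⟨fun _ _ h => Set.singleton_injective (congrArg Subtype.val h), fun X => by
      obtain ⟨p, hp, -⟩ := (hasDim_empty hr).exists_notMem X.2 (by simp) fun e => by
        have := (e ▸ hasDim_empty hr).unique X.2
        simp at this
      exact ⟨p, eq_of_subset (Set.singleton_subset_iff.2 hp)⟩⟩

theorem pointEquiv_val (hr : Pi.HasRank n) (p : P) : (pointEquiv hr p).1 = {p} := rfl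

theorem graph_zero_adj_iff (hr : Pi.HasRank n) (p q : P) :
    (Pi.graph 0).Adj (pointEquiv hr p) (pointEquiv hr q) ↔ ¬ Pi.Perp p q :=
  graph_adj_iff_not_perp hr (S := ∅) (by simpa using hasDim_empty hr) (Set.empty_subset _)
    (Set.empty_subset _) rfl (Set.notMem_empty p) rfl (Set.notMem_empty q)

theorem isSingular_line {L : Set P} (hL : L ∈ Pi.lines) : Pi.IsSingular L :=
  ⟨fun p hp q hq hne M hM hpM hqM => (Pi.line_unique p q hne M hM L hL hpM hqM hp hq).subset,
    fun _ hp _ hq hne => ⟨hne, L, hL, hp, hq⟩⟩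

/-- Lines are determined by orthogonality. -/
theorem line_eq_perp_perp {L : Set P} (hL : L ∈ Pi.lines) {p q : P} (hp : p ∈ L) (hq : q ∈ L)
    (hne : p ≠ q) : L = Pi.perp (Pi.perp {p, q}) := by
  have h : Pi.perp L = Pi.perp {p, q} := by
    refine (perp_anti (Set.insert_subset hp (Set.singleton_subset_iff.2 hq))).antisymm ?_
    intro x hx r hr
    exact perp_of_mem_line hL hp hq hr hne (hx p (by simp)) (hx q (by simp))
  rw [← h, (isSingular_line hL).perp_perp]

theorem image_perp (σ : P ≃ P) (h : ∀ p q, Pi.Perp (σ p) (σ q) ↔ Pi.Perp p q) (X : Set P) :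
    σ '' Pi.perp X = Pi.perp (σ '' X) := by
  ext p
  obtain ⟨p, rfl⟩ := σ.surjective p
  rw [σ.injective.mem_set_image]
  constructor
  · rintro hp _ ⟨x, hx, rfl⟩
    exact (h p x).2 (hp x hx)
  · exact fun hp x hx => (h p x).1 (hp _ (Set.mem_image_of_mem _ hx))

theorem image_mem_lines (σ : P ≃ P) (h : ∀ p q, Pi.Perp (σ p) (σ q) ↔ Pi.Perp p q) {L : Set P}
    (hL : L ∈ Pi.lines) : σ '' L ∈ Pi.lines := by
  obtain ⟨p, hp, q, hq, hne⟩ := Pi.line_nontrivial L hL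
  have hne' := σ.injective.ne hne
  obtain ⟨M, hM, hpM, hqM⟩ := exists_line ((h p q).2 (mem_line_perp hL hp hq)) hne'
  have e : σ '' L = M := by
    rw [line_eq_perp_perp hL hp hq hne, image_perp σ h, image_perp σ h, Set.image_pair,
      ← line_eq_perp_perp hM hpM hqM hne']
  exact e ▸ hM

/-- A permutation of the points preserving orthogonality is an automorphism. -/
def automorphismOfPerp (σ : P ≃ P) (h : ∀ p q, Pi.Perp (σ p) (σ q) ↔ Pi.Perp p q) :
    Pi.Automorphism where
  toEquiv := σ
  map_lines L := by
    refine ⟨fun hL => ?_, image_mem_lines σ h⟩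
    have := image_mem_lines σ.symm (fun p q => by
      rw [← h, σ.apply_symm_apply, σ.apply_symm_apply]) hL
    rwa [σ.symm_image_image] at this

theorem exists_automorphism_zero (hr : Pi.HasRank n) (f : Pi.graph 0 ≃g Pi.graph 0) :
    ∃ σ : Pi.Automorphism, ∀ X : Pi.Grassmannian 0, (f X).1 = σ.toEquiv '' X.1 := by
  refine ⟨automorphismOfPerp (((pointEquiv hr).trans f.toEquiv).trans (pointEquiv hr).symm)
    fun p q => ?_, fun X => ?_⟩
  · rw [← not_iff_not, ← graph_zero_adj_iff hr, ← graph_zero_adj_iff hr]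
    simp only [Equiv.trans_apply, Equiv.apply_symm_apply]
    exact f.map_adj_iff
  · obtain ⟨p, rfl⟩ := (pointEquiv hr).surjective X
    rw [pointEquiv_val, Set.image_singleton, ← pointEquiv_val hr]
    simp [automorphismOfPerp]

end

/-! ### Descent to points -/

theorem exists_hyperplane_through {j n : ℕ} (hr : Pi.HasRank n) (X : Pi.Grassmannian (j + 1))
    {p : P} (hp : p ∈ X.1) : ∃ S : Pi.Grassmannian j, p ∈ S.1 ∧ S.1 ⊆ X.1 := by
  obtain ⟨S, hS, hpS, hSX⟩ := HasDim.exists_between hr j (hasDim_singleton hr p) X.2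
    (Set.singleton_subset_iff.2 hp) (by push_cast; omega)
  exact ⟨⟨S, by simpa using hS⟩, hpS rfl, hSX⟩

/-- Induction on `k`: an automorphism of `Γ'_{j+1}` induces one of `Γ'_j`, and a subspace is the
union of its hyperplanes. -/
theorem exists_automorphism {n : ℕ} (hr : Pi.HasRank n) (k : ℕ) :
    k + 2 ≤ n → ∀ f : Pi.graph k ≃g Pi.graph k,
      ∃ σ : Pi.Automorphism, ∀ X : Pi.Grassmannian k, (f X).1 = σ.toEquiv '' X.1 := by
  induction k with
  | zero => exact fun _ f => exists_automorphism_zero hr f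
  | succ j ih =>
    intro hk f
    obtain ⟨g, hg⟩ := exists_equiv_hyperplane hr (by omega) f
    obtain ⟨σ, hσ⟩ := ih (by omega) ⟨g, fun {S T} => by
      rw [graph_adj_iff_weaklyJoined hr (by omega), graph_adj_iff_weaklyJoined hr (by omega)]
      exact weaklyJoined_map_iff g f.toEquiv hg S T⟩
    have hσ' : ∀ S, (g S).1 = σ.toEquiv '' S.1 := hσ
    refine ⟨σ, fun X => Set.Subset.antisymm (fun q hq => ?_) ?_⟩
    · obtain ⟨S', hqS, hS'⟩ := exists_hyperplane_through hr (f X) hq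
      obtain ⟨S, rfl⟩ := g.surjective S'
      rw [hσ'] at hqS
      exact Set.image_mono ((hg S X).1 hS') hqS
    · rintro _ ⟨p, hp, rfl⟩
      obtain ⟨S, hpS, hSX⟩ := exists_hyperplane_through hr X hp
      refine (hg S X).2 hSX ?_
      rw [hσ']
      exact Set.mem_image_of_mem _ hpS

end PolarSpace

theorem theorem1 {P : Type u} (Pi : PolarSpace P) (n k : ℕ) (hn : 3 ≤ n) (hrank : Pi.HasRank n)
    (hk : k + 2 ≤ n) (f : Pi.graph k ≃g Pi.graph k) :
    ∃ σ : Pi.Automorphism, ∀ X : Pi.Grassmannian k, (f X).1 = σ.toEquiv '' X.1 :=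
  PolarSpace.exists_automorphism hrank k hk f
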